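/- Let $M$ be a $\kappa$-saturated first-order structure, where $\kappa$ is an infinite cardinal (for instance, a monster model of a complete theory), and work in $M^{\mathrm{eq}}$, so that elements may be imaginaries (in particular finite tuples). Let $A\subseteq M^{\mathrm{eq}}$ with $|A|<\kappa$, and let $\pi(x)$ be a (consistent) partial type over $A$ in a variable $x$ of some sort of $M^{\mathrm{eq}}$. Definitions: - A *correspondence* on a partial type $\rho$ over $A$ is a non-empty type-definable set $C\subseteq\rho\times\rho$ such that all fibres $C_x=\{y\models\rho:(x,y)\in C\}$, $x\models\rho$, and $C^y=\{x\models\rho:(x,y)\in C\}$, $y\models\rho$, are finite. It is *uniform* if there are natural numbers $k_C,\ell_C$ with $|C_x|=k_C$ for all $x\models\rho$ and $|C^y|=\ell_C$ for all $y\models\rho$, and it is *balanced* if it is uniform and $k_C=\ell_C$. - $\rho$ is *measurable over $A$* if every $A$-type-definable uniform correspondence on $\rho$ is balanced. - $\mathrm{MR}$ denotes Morley rank, computed in $M^{\mathrm{eq}}$: the Morley rank of a partial type is the least Morley rank of a finite conjunction of formulas in it, and $\mathrm{MR}<\infty$ means that the rank is an ordinal (not necessarily finite). - A *completion* of $\pi$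 over $A$ is a complete type over $A$ containing $\pi$; it is *of maximal Morley rank* if no completion of $\pi$ over $A$ has larger Morley rank. **Theorem.** Suppose $\mathrm{MR}(\pi)<\infty$. If all completions of $\pi$ over $A$ of maximal Morley rank are measurable over $A$, then $\pi$ is measurable over $A$, i.e. every uniform $A$-type-definable correspondence on $\pi$ is balanced. -/

import Mathlib

universe u v w

namespace EqModel

/-- An imaginary sort of `M^eq`: a quotient of a finite Cartesian power `M ^ arity` by an
equivalence relation that is definable without parameters. Finite real tuples are the case of
equality; a finite tuple of imaginaries is an element of the sort given by the product of the
equivalence relations. -/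
structure ImagSort (L : FirstOrder.Language.{u, v}) (M : Type w) [L.Structure M] where
  arity : ℕ
  setoid : Setoid (Fin arity → M)
  definable : ∃ φ : L.Formula (Fin arity ⊕ Fin arity),
    ∀ x y : Fin arity → M, setoid x y ↔ φ.Realize (Sum.elim x y)

variable {L : FirstOrder.Language.{u, v}} {M : Type w} [L.Structure M]

/-- The elements of an imaginary sort. -/
abbrev ImagSort.Carrier (S : ImagSort L M) : Type w := Quotient S.setoid

/-- The class of a real tuple. -/
def ImagSort.toEq (S : ImagSort L M) (x : Fin S.arity → M) : S.Carrier :=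
  Quotient.mk S.setoid x

/-- The class of a pair of real tuples, in a product of two sorts. -/
def ImagSort.pairToEq (S S' : ImagSort L M) (x : Fin S.arity ⊕ Fin S'.arity → M) :
    S.Carrier × S'.Carrier :=
  (S.toEq (x ∘ Sum.inl), S'.toEq (x ∘ Sum.inr))

variable (L M) in
/-- The elements of `M^eq`: real tuples modulo definable equivalence relations. -/
structure Imag where
  sort : ImagSort L M
  val : sort.Carrier

/-- Let `q : (α → M) → Q` present `Q` as a (product of) sort(s) of `M^eq`, and let `A` be a set of
elements of `M^eq`. A set `X ⊆ Q` is definable over `A` if there are finitely many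
`a₁, …, aₘ ∈ A` and a formula `φ(x, z₁, …, zₘ)` without parameters which, evaluated at
representatives `x` of an element of `Q` and `zᵢ` of `aᵢ`, expresses membership in `X`,
whatever the choice of the representatives. -/
def DefinableOver (A : Set (Imag L M)) {α : Type} {Q : Type w} (q : (α → M) → Q)
    (X : Set Q) : Prop :=
  ∃ (m : ℕ) (a : Fin m → Imag L M), (∀ i, a i ∈ A) ∧
    ∃ φ : L.Formula (α ⊕ (Σ i : Fin m, Fin (a i).sort.arity)),
      ∀ (x : α → M) (z : ∀ i : Fin m, Fin (a i).sort.arity → M),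
        (∀ i, (a i).sort.toEq (z i) = (a i).val) →
          (q x ∈ X ↔ φ.Realize (Sum.elim x (fun j => z j.1 j.2)))

/-- A set is type-definable over `A` if it is an intersection of sets definable over `A`. -/
def TypeDefinableOver (A : Set (Imag L M)) {α : Type} {Q : Type w} (q : (α → M) → Q)
    (X : Set Q) : Prop :=
  ∃ F : Set (Set Q), (∀ Y ∈ F, DefinableOver A q Y) ∧ X = ⋂₀ F

variable (L M) in
/-- `M` is `κ`-saturated: over any set `B` of fewer than `κ` parameters, every finitely
satisfiable set of formulas in finitely many variables is realised in `M`. -/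
def IsSaturated (κ : Cardinal.{w}) : Prop :=
  ∀ (B : Set M), Cardinal.mk B < κ → ∀ (n : ℕ) (F : Set (Set (Fin n → M))),
    (∀ X ∈ F, B.Definable L X) →
    (∀ G : Set (Set (Fin n → M)), G.Finite → G ⊆ F → (⋂₀ G).Nonempty) →
    (⋂₀ F).Nonempty

/-- A partial type over `A` in a variable of sort `S`: a finitely satisfiable set of formulas over
`A`. A formula is identified with the set it defines in `M^eq`. -/
structure PartialType (A : Set (Imag L M)) (S : ImagSort L M) where
  formulas : Set (Set S.Carrier)
  definable : ∀ X ∈ formulas, DefinableOver A S.toEq X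
  consistent : ∀ G : Set (Set S.Carrier), G.Finite → G ⊆ formulas → (⋂₀ G).Nonempty

namespace PartialType

variable {A : Set (Imag L M)} {S S' : ImagSort L M}

/-- The set of realisations. -/
def realizations (π : PartialType A S) : Set S.Carrier := ⋂₀ π.formulas

/-- Complete types decide every formula over `A`. -/
def IsComplete (p : PartialType A S) : Prop :=
  ∀ X : Set S.Carrier, DefinableOver A S.toEq X → X ∈ p.formulas ∨ Xᶜ ∈ p.formulas

/-- `p` is a completion of `π` over `A`. -/
def IsCompletionOf (p π : PartialType A S) : Prop :=
  p.IsComplete ∧ π.formulas ⊆ p.formulas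

/-- A correspondence over `A` between `π(x)` and `π'(y)`: a non-empty `A`-type-definable subset
of `π × π'` all of whose fibres are finite. -/
def IsCorrespondence (π : PartialType A S) (π' : PartialType A S')
    (C : Set (S.Carrier × S'.Carrier)) : Prop :=
  TypeDefinableOver A (S.pairToEq S') C ∧ C.Nonempty ∧ C ⊆ π.realizations ×ˢ π'.realizations ∧
    (∀ x ∈ π.realizations, {y | (x, y) ∈ C}.Finite) ∧
    (∀ y ∈ π'.realizations, {x | (x, y) ∈ C}.Finite)

/-- All the fibres `C_x`, for `x ⊨ π`, have exactly `k` elements, and all the fibres `C^y`, for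
`y ⊨ π'`, have exactly `l` elements. -/
def HasFibreSizes (π : PartialType A S) (π' : PartialType A S')
    (C : Set (S.Carrier × S'.Carrier)) (k l : ℕ) : Prop :=
  (∀ x ∈ π.realizations, {y | (x, y) ∈ C}.encard = k) ∧
    (∀ y ∈ π'.realizations, {x | (x, y) ∈ C}.encard = l)

/-- A uniform correspondence. -/
def IsUniformCorrespondence (π : PartialType A S) (π' : PartialType A S')
    (C : Set (S.Carrier × S'.Carrier)) : Prop :=
  IsCorrespondence π π' C ∧ ∃ k l : ℕ, HasFibreSizes π π' C k l

/-- A balanced correspondence: it is uniform, and the two fibre sizes agree. -/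
def IsBalanced (π : PartialType A S) (π' : PartialType A S')
    (C : Set (S.Carrier × S'.Carrier)) : Prop :=
  IsCorrespondence π π' C ∧ ∃ k l : ℕ, HasFibreSizes π π' C k l ∧ k = l

/-- `π` is measurable over `A`: every `A`-type-definable uniform correspondence on `π` is
balanced. -/
def IsMeasurable (π : PartialType A S) : Prop :=
  ∀ C : Set (S.Carrier × S.Carrier), IsUniformCorrespondence π π C → IsBalanced π π C

end PartialType

/-- `MorleyRankGe X α` says that the definable set `X` has Morley rank at least `α`: `X` is
non-empty and, for every `β < α`, it contains infinitely many pairwise disjoint sets, definable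
with parameters in `M^eq`, of Morley rank at least `β`. (For `α = β + 1` only `β` matters, and
for limit `α` this says that the rank is at least every `β < α`.) -/
def MorleyRankGe {S : ImagSort L M} (X : Set S.Carrier) (α : Ordinal.{w}) : Prop :=
  X.Nonempty ∧ ∀ β : Ordinal.{w}, β < α → ∃ Y : ℕ → Set S.Carrier,
    (∀ i, DefinableOver (Set.univ : Set (Imag L M)) S.toEq (Y i)) ∧ (∀ i, Y i ⊆ X) ∧
    (∀ i j, i ≠ j → Disjoint (Y i) (Y j)) ∧ ∀ i, MorleyRankGe (Y i) β
termination_by α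

open Classical in
/-- The Morley rank of a definable set: `⊥` for the empty set, `⊤` (that is, `∞`) if the rank is
at least every ordinal, and otherwise the largest `α` with rank at least `α`. -/
noncomputable def morleyRank {S : ImagSort L M} (X : Set S.Carrier) :
    WithBot (WithTop Ordinal.{w}) :=
  if X.Nonempty then
    ((sSup {r : WithTop Ordinal.{w} | ∃ α : Ordinal.{w}, r = α ∧ MorleyRankGe X α} :
      WithTop Ordinal.{w}) : WithBot (WithTop Ordinal.{w}))
  else ⊥

/-- The Morley rank of a partial type: the least Morley rank of a finite conjunction of formulas
in it. -/
noncomputable def PartialType.morleyRank {A : Set (Imag L M)} {S : ImagSort L M}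
    (π : PartialType A S) : WithBot (WithTop Ordinal.{w}) :=
  sInf {r | ∃ G : Set (Set S.Carrier), G.Finite ∧ G ⊆ π.formulas ∧ r = EqModel.morleyRank (⋂₀ G)}

/-- `p` is a completion of `π` over `A` of maximal Morley rank among the completions of `π`
over `A`. -/
def PartialType.IsMaxRankCompletionOf {A : Set (Imag L M)} {S : ImagSort L M}
    (p π : PartialType A S) : Prop :=
  p.IsCompletionOf π ∧
    ∀ q : PartialType A S, q.IsCompletionOf π → q.morleyRank ≤ p.morleyRank

end EqModel

/-! Write deg(y/x) for the number of conjugates of `y` over `A` and `x` (`degreeOver A x y`). The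
theorem is a detailed-balance argument: a weight on a suitable part `X` of the realisations turns
the double count of `C` into a comparison of the two fibre sizes.

Choose a realisation x₀ of `π` whose type over `A` has maximal rank β, and let `X` be the set of
realisations of `π` interalgebraic with x₀ over `A`. Since `C` is `A`-invariant with finite fibres,
`C`-related elements are interalgebraic (`TypeDefinableOver.interalg`), so `C` never leaves `X` and
keeps its fibre sizes there. Interalgebraic elements have the same rank
(`CompactOver.rankOverGe_of_interalg`), and a formula of rank β meets only finitely many types of
rank β (`finite_tupleType_image`), so `X` carries finitely many types over `A`, all of them maximal.

Put W(x) = deg(x/x₀)/deg(x₀/x). Degrees multiply in towers, and counting the conjugates of a triple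
in different orders gives a cocycle identity (`CompactOver.degreeOver_cocycle`), that is,
W(x)·deg(y/x) = W(y)·deg(x/y) on `X`. If x and y have the same type, measurability applied to the
correspondence "(x', y') has the type of (x, y)" gives deg(y/x) = deg(x/y)
(`CompactOver.degreeOver_comm`), hence W(x) = W(y): the weight depends only on the type.

Finally (`CompactOver.eq_of_weight`), choose one representative of each type in `X`. The weighted
count of pairs in `C` with first entry a representative is k·ΣW, that with second entry a
representative is l·ΣW, and detailed balance equates the two, one pair type at a time. As ΣW > 0, k
= l. -/

namespace EqModel

open FirstOrder Cardinal

variable {L : FirstOrder.Language.{u, v}} {M : Type w} [L.Structure M]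
variable {A : Set (Imag L M)} {S : ImagSort L M}

/-! ### Closure properties of definable sets in M^eq. -/

section Definability

variable {α β : Type} {Q Q' : Type w} {q : (α → M) → Q} {q' : (β → M) → Q'}

/-- In `DefinableOver`, the parameters may be indexed by any finite type. -/
theorem DefinableOver.of_finite {ι : Type} [Finite ι] (a : ι → Imag L M) (ha : ∀ i, a i ∈ A)
    {W : Set ((α ⊕ (Σ i, Fin (a i).sort.arity)) → M)} (hW : (∅ : Set M).Definable L W)
    {X : Set Q}
    (h : ∀ (x : α → M) (z : ∀ i, Fin (a i).sort.arity → M),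
      (∀ i, (a i).sort.toEq (z i) = (a i).val) →
        (q x ∈ X ↔ Sum.elim x (fun j : Σ i, Fin (a i).sort.arity => z j.1 j.2) ∈ W)) :
    DefinableOver A q X := by
  obtain ⟨m, ⟨e⟩⟩ := Finite.exists_equiv_fin ι
  obtain ⟨φ, rfl⟩ := Set.empty_definable_iff.1 hW
  let E : (Σ i : Fin m, Fin (a (e.symm i)).sort.arity) ≃ (Σ i, Fin (a i).sort.arity) :=
    Equiv.sigmaCongrLeft (β := fun i => Fin (a i).sort.arity) e.symm
  refine ⟨m, fun i => a (e.symm i), fun i => ha _, φ.relabel (Sum.map id E.symm), ?_⟩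
  intro x z hz
  rw [Language.Formula.realize_relabel,
    h x (fun i r => z (E.symm ⟨i, r⟩).1 (E.symm ⟨i, r⟩).2) ?_]
  · rw [Set.mem_ofPred_eq]
    refine iff_of_eq (congrArg _ ?_)
    funext j
    rcases j with j | j <;> rfl
  · intro i
    obtain ⟨i, rfl⟩ := e.symm.surjective i
    have : ∀ r, E.symm ⟨e.symm i, r⟩ = ⟨i, r⟩ := fun r => by
      rw [Equiv.symm_apply_eq]; rfl
    have h' : (fun r => z (E.symm ⟨e.symm i, r⟩).1 (E.symm ⟨e.symm i, r⟩).2) = z i := by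
      funext r; rw [this]
    exact (congrArg _ h').trans (hz i)

theorem DefinableOver.exists_definable {X : Set Q} (h : DefinableOver A q X) :
    ∃ (m : ℕ) (a : Fin m → Imag L M), (∀ i, a i ∈ A) ∧
      ∃ W : Set ((α ⊕ (Σ i, Fin (a i).sort.arity)) → M), (∅ : Set M).Definable L W ∧
        ∀ (x : α → M) (z : ∀ i, Fin (a i).sort.arity → M),
          (∀ i, (a i).sort.toEq (z i) = (a i).val) →
            (q x ∈ X ↔ Sum.elim x (fun j : Σ i, Fin (a i).sort.arity => z j.1 j.2) ∈ W) := by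
  obtain ⟨m, a, ha, φ, h⟩ := h
  exact ⟨m, a, ha, Set.ofPred φ.Realize, Set.empty_definable_iff.2 ⟨φ, rfl⟩, h⟩

theorem DefinableOver.mono {B : Set (Imag L M)} {X : Set Q} (h : DefinableOver A q X)
    (hAB : A ⊆ B) : DefinableOver B q X := by
  obtain ⟨m, a, ha, h⟩ := h
  exact ⟨m, a, fun i => hAB (ha i), h⟩

theorem DefinableOver.compl {X : Set Q} (h : DefinableOver A q X) : DefinableOver A q Xᶜ := by
  obtain ⟨m, a, ha, W, hW, h⟩ := h.exists_definable
  exact .of_finite a ha hW.compl fun x z hz => not_congr (h x z hz)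

theorem DefinableOver.of_definable {X : Set Q} (h : (∅ : Set M).Definable L (q ⁻¹' X)) :
    DefinableOver A q X := by
  refine .of_finite (fun i : Empty => i.elim) (fun i => i.elim)
    (h.preimage_comp (Sum.inl : α → _)) fun x z _ => ?_
  simp [Sum.elim_comp_inl]

theorem DefinableOver.univ : DefinableOver A q Set.univ :=
  .of_definable (by simp)

theorem DefinableOver.inter {X Y : Set Q} (hX : DefinableOver A q X) (hY : DefinableOver A q Y) :
    DefinableOver A q (X ∩ Y) := by
  obtain ⟨m, a, ha, W, hW, hX⟩ := hX.exists_definable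
  obtain ⟨n, b, hb, V, hV, hY⟩ := hY.exists_definable
  let c : Fin m ⊕ Fin n → Imag L M := Sum.elim a b
  let f : α ⊕ (Σ i, Fin (a i).sort.arity) → α ⊕ (Σ i, Fin (c i).sort.arity) :=
    Sum.map id fun j => ⟨Sum.inl j.1, j.2⟩
  let g : α ⊕ (Σ i, Fin (b i).sort.arity) → α ⊕ (Σ i, Fin (c i).sort.arity) :=
    Sum.map id fun j => ⟨Sum.inr j.1, j.2⟩
  refine .of_finite c ?_ ((hW.preimage_comp f).inter (hV.preimage_comp g)) fun x z hz => ?_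
  · rintro (i | i)
    exacts [ha i, hb i]
  · refine and_congr ((hX x (fun i => z (Sum.inl i)) fun i => hz (Sum.inl i)).trans ?_)
      ((hY x (fun i => z (Sum.inr i)) fun i => hz (Sum.inr i)).trans ?_)
    · refine iff_of_eq (congrArg (· ∈ W) ?_)
      funext j
      rcases j with j | j <;> rfl
    · refine iff_of_eq (congrArg (· ∈ V) ?_)
      funext j
      rcases j with j | j <;> rfl

theorem DefinableOver.union {X Y : Set Q} (hX : DefinableOver A q X) (hY : DefinableOver A q Y) :
    DefinableOver A q (X ∪ Y) := by
  simpa [Set.compl_inter] using (hX.compl.inter hY.compl).compl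

theorem DefinableOver.diff {X Y : Set Q} (hX : DefinableOver A q X) (hY : DefinableOver A q Y) :
    DefinableOver A q (X \ Y) := hX.inter hY.compl

theorem DefinableOver.empty : DefinableOver A q (∅ : Set Q) := by
  simpa using (DefinableOver.univ (A := A) (q := q)).compl

theorem DefinableOver.finset_inter {ι : Type*} {X : ι → Set Q} (s : Finset ι)
    (h : ∀ i ∈ s, DefinableOver A q (X i)) : DefinableOver A q (⋂ i ∈ s, X i) := by
  classical
  induction s using Finset.induction_on with
  | empty => simpa using DefinableOver.univ
  | insert i s _ ih =>
    rw [Finset.set_biInter_insert]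
    exact (h i (by simp)).inter (ih fun j hj => h j (by simp [hj]))

theorem DefinableOver.finset_union {ι : Type*} {X : ι → Set Q} (s : Finset ι)
    (h : ∀ i ∈ s, DefinableOver A q (X i)) : DefinableOver A q (⋃ i ∈ s, X i) := by
  classical
  induction s using Finset.induction_on with
  | empty => simpa using DefinableOver.empty
  | insert i s _ ih =>
    rw [Finset.set_biUnion_insert]
    exact (h i (by simp)).union (ih fun j hj => h j (by simp [hj]))

theorem DefinableOver.sInter {G : Set (Set Q)} (hG : G.Finite)
    (h : ∀ X ∈ G, DefinableOver A q X) : DefinableOver A q (⋂₀ G) := by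
  have := DefinableOver.finset_inter (X := id) hG.toFinset (A := A) (q := q) (by simpa using h)
  rw [Set.sInter_eq_biInter]
  simpa using this

theorem DefinableOver.preimage {X : Set Q} (hX : DefinableOver A q X) (f : α → β) (p : Q' → Q)
    (hp : ∀ y, p (q' y) = q (y ∘ f)) : DefinableOver A q' (p ⁻¹' X) := by
  obtain ⟨m, a, ha, W, hW, hX⟩ := hX.exists_definable
  refine .of_finite a ha (hW.preimage_comp (Sum.map f id)) fun y z hz => ?_
  rw [Set.mem_preimage, hp, hX _ z hz]
  refine iff_of_eq (congrArg (· ∈ W) ?_)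
  funext j
  rcases j with j | j <;> rfl

/-- Existential quantification ranges over real representatives. `hlift` is what makes this agree
with the image in the quotient: a preimage of a class has a representative extending any prescribed
representative of that class. -/
theorem DefinableOver.image [Finite α] [Finite β] {Y : Set Q'} (hY : DefinableOver A q' Y)
    (f : α → β) (p : Q' → Q) (hp : ∀ y, p (q' y) = q (y ∘ f))
    (hlift : ∀ x v, p v = q x → ∃ y, q' y = v ∧ y ∘ f = x) : DefinableOver A q (p '' Y) := by
  obtain ⟨m, a, ha, W, hW, hY⟩ := hY.exists_definable
  refine .of_finite a ha (hW.image_comp (Sum.map f id)) fun x z hz => ?_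
  constructor
  · rintro ⟨v, hv, hvx⟩
    obtain ⟨y, rfl, rfl⟩ := hlift x v hvx
    refine ⟨_, (hY y z hz).1 hv, ?_⟩
    funext j
    rcases j with j | j <;> rfl
  · rintro ⟨g, hg, hgx⟩
    have h1 : g = Sum.elim (g ∘ Sum.inl) (fun j => z j.1 j.2) := by
      funext j
      rcases j with j | j
      · rfl
      · exact congrFun hgx (Sum.inr j)
    have h2 : (g ∘ Sum.inl) ∘ f = x := by
      funext j
      exact congrFun hgx (Sum.inl j)
    rw [h1] at hg
    exact ⟨_, (hY _ z hz).2 hg, by rw [hp, h2]⟩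

end Definability

/-! ### Tuples of elements of one sort. -/

/-- The family of classes of a family of real tuples. -/
def ImagSort.tuple (S : ImagSort L M) (I : Type) (x : I × Fin S.arity → M) : I → S.Carrier :=
  fun i => S.toEq fun r => x (i, r)

theorem ImagSort.toEq_surjective (S : ImagSort L M) : Function.Surjective S.toEq :=
  Quotient.mk_surjective

theorem ImagSort.exists_tuple_lift {I J : Type} {f : I → J} (hf : Function.Injective f)
    {x : I × Fin S.arity → M} {v : J → S.Carrier} (h : v ∘ f = S.tuple I x) :
    ∃ y, S.tuple J y = v ∧ y ∘ Prod.map f id = x := by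
  classical
  choose z hz using fun j => S.toEq_surjective (v j)
  refine ⟨fun p => if h : ∃ i, f i = p.1 then x (h.choose, p.2) else z p.1 p.2, ?_, ?_⟩
  · funext j
    by_cases hj : ∃ i, f i = j
    · obtain ⟨i, rfl⟩ := hj
      have h1 : ∃ i', f i' = f i := ⟨i, rfl⟩
      have h2 : h1.choose = i := hf h1.choose_spec
      have := congrFun h i
      simp only [Function.comp_apply] at this
      rw [this]
      simp only [ImagSort.tuple, h1, dif_pos, h2]
    · simp only [ImagSort.tuple, hj, dif_neg, not_false_eq_true, hz]
  · funext ⟨i, r⟩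
    have h1 : ∃ i', f i' = f i := ⟨i, rfl⟩
    have h2 : h1.choose = i := hf h1.choose_spec
    simp [h1, h2]

theorem ImagSort.tuple_surjective (S : ImagSort L M) (I : Type) :
    Function.Surjective (S.tuple I) := fun v => by
  choose z hz using fun i => S.toEq_surjective (v i)
  exact ⟨fun p => z p.1 p.2, funext hz⟩

/-- Definability over `A` of a set of `I`-tuples of elements of sort `S`. -/
abbrev TupleDef (A : Set (Imag L M)) (I : Type) (X : Set (I → S.Carrier)) : Prop :=
  DefinableOver A (S.tuple I) X

section Tuples

variable {I J : Type}

theorem TupleDef.comap {X : Set (I → S.Carrier)} (hX : TupleDef A I X) (f : I → J) :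
    TupleDef A J {v | v ∘ f ∈ X} :=
  DefinableOver.preimage hX (Prod.map f id) (fun v => v ∘ f) fun _ => rfl

theorem TupleDef.map [Finite I] [Finite J] {X : Set (J → S.Carrier)} (hX : TupleDef A J X)
    {f : I → J} (hf : Function.Injective f) : TupleDef A I ((fun v => v ∘ f) '' X) :=
  DefinableOver.image hX (Prod.map f id) (fun v => v ∘ f) (fun _ => rfl)
    fun _ _ h => ImagSort.exists_tuple_lift hf h

theorem tupleDef_apply_mem {X : Set S.Carrier} (hX : DefinableOver A S.toEq X) (i : I) :
    TupleDef A I {v | v i ∈ X} :=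
  DefinableOver.preimage hX (fun r => (i, r)) (fun v : I → S.Carrier => v i) fun _ => rfl

theorem TupleDef.const_mem {X : Set (Fin 1 → S.Carrier)} (hX : TupleDef A (Fin 1) X) :
    DefinableOver A S.toEq {x | ![x] ∈ X} :=
  DefinableOver.preimage hX Prod.snd (fun x => ![x]) fun y => by
    funext i; fin_cases i; rfl

theorem tupleDef_pair_mem {X : Set (S.Carrier × S.Carrier)}
    (hX : DefinableOver A (S.pairToEq S) X) : TupleDef A (Fin 2) {v | (v 0, v 1) ∈ X} :=
  DefinableOver.preimage hX (Sum.elim (fun r => (0, r)) (fun r => (1, r)))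
    (fun v : Fin 2 → S.Carrier => (v 0, v 1)) fun _ => rfl

theorem TupleDef.pair_mem {X : Set (Fin 2 → S.Carrier)} (hX : TupleDef A (Fin 2) X) :
    DefinableOver A (S.pairToEq S) {p | ![p.1, p.2] ∈ X} :=
  DefinableOver.preimage hX (fun p => if p.1 = 0 then Sum.inl p.2 else Sum.inr p.2)
    (fun p : S.Carrier × S.Carrier => ![p.1, p.2]) fun y => by
      funext i; fin_cases i <;> rfl

theorem tupleDef_eq (i j : I) : TupleDef A I {v : I → S.Carrier | v i = v j} := by
  have h2 : TupleDef A (Fin 2) {v : Fin 2 → S.Carrier | v 0 = v 1} := by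
    obtain ⟨φ, hφ⟩ := S.definable
    refine .of_definable (Set.empty_definable_iff.2
      ⟨φ.relabel (Sum.elim (fun r => (0, r)) (fun r => (1, r))), ?_⟩)
    ext x
    refine Iff.trans (Quotient.eq (r := S.setoid)) ((hφ _ _).trans ?_)
    rw [Set.mem_ofPred_eq, Language.Formula.realize_relabel]
    refine iff_of_eq (congrArg _ ?_)
    funext j
    rcases j with j | j <;> rfl
  exact h2.comap ![i, j]

theorem tupleDef_ne (i j : I) : TupleDef A I {v : I → S.Carrier | v i ≠ v j} :=
  (tupleDef_eq i j).compl

theorem TupleDef.iInter {ι : Type*} [Finite ι] {X : ι → Set (I → S.Carrier)}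
    (h : ∀ i, TupleDef A I (X i)) : TupleDef A I (⋂ i, X i) := by
  cases nonempty_fintype ι
  simpa using DefinableOver.finset_inter (A := A) (X := X) Finset.univ fun i _ => h i

theorem tupleDef_injective_comp [Finite I] (f : I → J) :
    TupleDef A J {v : J → S.Carrier | Function.Injective (v ∘ f)} := by
  have : {v : J → S.Carrier | Function.Injective (v ∘ f)} =
      ⋂ i, ⋂ j, {v | i = j ∨ v (f i) ≠ v (f j)} := by
    ext v
    simp only [Function.Injective, Function.comp_apply, Set.mem_ofPred_eq, Set.mem_iInter]
    exact forall_congr' fun i => forall_congr' fun j => by tauto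
  rw [this]
  refine .iInter fun i => .iInter fun j => ?_
  by_cases h : i = j
  · simpa [h] using DefinableOver.univ
  · simpa [h] using tupleDef_ne (f i) (f j)

end Tuples

/-! ### Compactness in M^eq from saturation of the real structure. -/

/-- Compactness over `A` for tuples of elements of sort `S`: a directed family of `A`-definable
sets of `J`-tuples, each of which contains an extension of the `I`-tuple `b`, has an extension
of `b` in common. -/
def CompactOver (A : Set (Imag L M)) (S : ImagSort L M) : Prop :=
  ∀ {I J : Type} [Finite I] [Finite J] (f : I → J), Function.Injective f →
    ∀ (b : I → S.Carrier) (D : Set (Set (J → S.Carrier))), D.Nonempty →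
      (∀ X ∈ D, TupleDef A J X) → (∀ X ∈ D, ∀ Y ∈ D, ∃ Z ∈ D, Z ⊆ X ∩ Y) →
      (∀ X ∈ D, ∃ u ∈ X, u ∘ f = b) → ∃ u, u ∘ f = b ∧ ∀ X ∈ D, u ∈ X

theorem mk_range_representatives_lt {κ : Cardinal.{w}} (hκ : ℵ₀ ≤ κ) (hA : #A < κ)
    (z : ∀ a : Imag L M, Fin a.sort.arity → M) :
    #(Set.range fun p : Σ a : A, Fin a.1.sort.arity => z p.1 p.2) < κ := by
  refine mk_range_le.trans_lt ?_
  rcases finite_or_infinite A with h | h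
  · exact (lt_aleph0_of_finite _).trans_le hκ
  · let g : (Σ a : A, Fin a.1.sort.arity) → A × ULift.{w} ℕ := fun p => (p.1, ⟨p.2⟩)
    have hg : Function.Injective g := by
      rintro ⟨a, i⟩ ⟨b, j⟩ h
      simp only [g, Prod.mk.injEq, ULift.up.injEq] at h
      obtain ⟨rfl, h⟩ := h
      simp [Fin.ext h]
    refine (mk_le_of_injective hg).trans_lt ?_
    have : #(A × ULift.{w} ℕ) = #A := by
      simp
    rwa [this]

theorem definable_substitute {α σ : Type} {B : Set M} {W : Set (α ⊕ σ → M)}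
    (hW : (∅ : Set M).Definable L W) (z : σ → M) (hz : ∀ i, z i ∈ B) :
    B.Definable L {x : α → M | Sum.elim x z ∈ W} := by
  obtain ⟨φ, rfl⟩ := Set.empty_definable_iff.1 hW
  refine Set.definable_iff_exists_formula_sum.2
    ⟨φ.relabel (Sum.elim Sum.inr fun i => Sum.inl ⟨z i, hz i⟩), ?_⟩
  ext x
  simp only [Set.mem_ofPred_eq, Language.Formula.realize_relabel]
  refine iff_of_eq (congrArg _ ?_)
  funext j
  rcases j with j | j <;> rfl

theorem definable_apply_eq {α : Type} {B : Set M} (j : α) {c : M} (hc : c ∈ B) :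
    B.Definable L {x : α → M | x j = c} := by
  have h : (∅ : Set M).Definable L {y : α ⊕ Unit → M | y (Sum.inl j) = y (Sum.inr ())} :=
    Set.empty_definable_iff.2
      ⟨(Language.var (Sum.inl j)).equal (Language.var (Sum.inr ())), by
        ext y; simp [Language.Formula.realize_equal]⟩
  exact definable_substitute h (fun _ => c) fun _ => hc

/-- Fix one real representative for each parameter in `A` and for each entry of `b`; this is still a
set of fewer than κ parameters. The conditions then become definable sets of real tuples, and
directedness reduces finite satisfiability to a single member of `D`. -/
theorem IsSaturated.compactOver {κ : Cardinal.{w}} (hκ : ℵ₀ ≤ κ) (hM : IsSaturated L M κ)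
    (hA : #A < κ) (S : ImagSort L M) : CompactOver A S := by
  intro I J _ _ f hf b D hne hD hdir hb
  choose z hz using fun a : Imag L M => a.sort.toEq_surjective a.val
  obtain ⟨b, rfl⟩ := S.tuple_surjective I b
  let B : Set M := (Set.range fun p : Σ a : A, Fin a.1.sort.arity => z p.1 p.2) ∪ Set.range b
  have hB : #B < κ := (mk_union_le _ _).trans_lt (add_lt_of_lt hκ
    (mk_range_representatives_lt hκ hA z) ((Set.finite_range b).lt_aleph0.trans_le hκ))
  obtain ⟨n, ⟨e⟩⟩ := Finite.exists_equiv_fin (J × Fin S.arity)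
  let T : Set (J → S.Carrier) → Set (J × Fin S.arity → M) := fun X =>
    {x | S.tuple J x ∈ X} ∩ {x | x ∘ Prod.map f id = b}
  have hT : ∀ X ∈ D, B.Definable L (T X) := by
    intro X hX
    refine .inter ?_ ?_
    · obtain ⟨m, a, ha, W, hW, h⟩ := (hD X hX).exists_definable
      have h' : {x | S.tuple J x ∈ X} =
          {x | Sum.elim x (fun j : Σ i, Fin (a i).sort.arity => z (a j.1) j.2) ∈ W} := by
        ext x
        exact h x _ fun i => hz _
      rw [h']
      exact definable_substitute hW _ fun i => Or.inl ⟨⟨⟨a i.1, ha _⟩, i.2⟩, rfl⟩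
    · cases nonempty_fintype I
      have h' : {x : J × Fin S.arity → M | x ∘ Prod.map f id = b} =
          ⋂ p ∈ (Finset.univ : Finset (I × Fin S.arity)), {x | x (Prod.map f id p) = b p} := by
        ext x
        simp [funext_iff]
      rw [h']
      exact Set.definable_biInter_finset
        (fun p => definable_apply_eq (B := B) (Prod.map f id p) (c := b p) (Or.inr ⟨p, rfl⟩)) _
  have hdir' : ∀ G : Set (Set (Fin n → M)), G.Finite →
      G ⊆ {Y | ∃ X ∈ D, Y = {y | y ∘ e ∈ T X}} → ∃ X ∈ D, {y | y ∘ e ∈ T X} ⊆ ⋂₀ G := by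
    intro G hG
    induction G, hG using Set.Finite.induction_on with
    | empty => exact fun _ => ⟨_, hne.some_mem, by simp⟩
    | @insert Y G _ _ ih =>
      intro h
      obtain ⟨X, hX, hXG⟩ := ih ((Set.subset_insert _ _).trans h)
      obtain ⟨X', hX', rfl⟩ := h (Set.mem_insert _ _)
      obtain ⟨Z, hZ, hZX⟩ := hdir X hX X' hX'
      refine ⟨Z, hZ, ?_⟩
      rw [Set.sInter_insert]
      exact fun y hy => ⟨⟨(hZX hy.1).2, hy.2⟩, hXG ⟨(hZX hy.1).1, hy.2⟩⟩
  obtain ⟨y, hy⟩ : (⋂₀ {Y | ∃ X ∈ D, Y = {y : Fin n → M | y ∘ e ∈ T X}}).Nonempty := by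
    refine hM B hB n _ ?_ fun G hG hGF => ?_
    · rintro _ ⟨X, hX, rfl⟩
      exact (hT X hX).preimage_comp e
    · obtain ⟨X, hX, hXG⟩ := hdir' G hG hGF
      obtain ⟨u, hu, hub⟩ := hb X hX
      obtain ⟨x, rfl, hx⟩ := ImagSort.exists_tuple_lift hf hub
      have hxe : (x ∘ e.symm) ∘ e = x := by funext; simp
      exact ⟨x ∘ e.symm, hXG (by rw [Set.mem_ofPred_eq, hxe]; exact ⟨hu, hx⟩)⟩
  refine ⟨S.tuple J (y ∘ e), ?_, fun X hX => (hy _ ⟨X, hX, rfl⟩).1⟩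
  have := (hy _ ⟨_, hne.some_mem, rfl⟩).2
  exact (congrArg (S.tuple I) this :)

/-! ### Types of tuples and counting of conjugates. -/

/-- Two tuples have the same type over `A`. -/
def EqType (A : Set (Imag L M)) {I : Type} (v v' : I → S.Carrier) : Prop :=
  ∀ X, TupleDef A I X → (v ∈ X ↔ v' ∈ X)

section EqType

variable {I J K : Type}

theorem EqType.refl (v : I → S.Carrier) : EqType A v v := fun _ _ => Iff.rfl

theorem EqType.symm {v v' : I → S.Carrier} (h : EqType A v v') : EqType A v' v :=
  fun X hX => (h X hX).symm

theorem EqType.trans {v v' v'' : I → S.Carrier} (h : EqType A v v') (h' : EqType A v' v'') :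
    EqType A v v'' := fun X hX => (h X hX).trans (h' X hX)

theorem EqType.comp {v v' : J → S.Carrier} (h : EqType A v v') (f : I → J) :
    EqType A (v ∘ f) (v' ∘ f) := fun _ hX => h _ (hX.comap f)

theorem EqType.apply_eq_iff {v v' : I → S.Carrier} (h : EqType A v v') (i j : I) :
    v i = v j ↔ v' i = v' j := h _ (tupleDef_eq i j)

/-- The projection along `f` of any `A`-definable set containing `u` is `A`-definable and contains
`u ∘ f`, hence `v`; compactness does the rest. This plays the role of homogeneity, so no
automorphisms are needed. -/
theorem CompactOver.exists_extension (hS : CompactOver A S) [Finite I] [Finite J] {f : I → J}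
    (hf : Function.Injective f) {u : J → S.Carrier} {v : I → S.Carrier}
    (h : EqType A (u ∘ f) v) : ∃ u', u' ∘ f = v ∧ EqType A u' u := by
  obtain ⟨u', hu', hu⟩ := hS f hf v {X | TupleDef A J X ∧ u ∈ X} ⟨_, .univ, trivial⟩
    (fun X hX => hX.1) (fun X hX Y hY => ⟨X ∩ Y, ⟨hX.1.inter hY.1, hX.2, hY.2⟩, subset_rfl⟩)
    (fun X hX => (h _ (hX.1.map hf)).1 ⟨u, hX.2, rfl⟩)
  refine ⟨u', hu', fun X hX => ⟨fun h1 => ?_, fun h1 => hu X ⟨hX, h1⟩⟩⟩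
  by_contra h2
  exact hu _ ⟨hX.compl, h2⟩ h1

/-- The conjugates of `u` over `A` that agree with `u` along `f`. -/
def conjugates (A : Set (Imag L M)) (f : I → J) (u : J → S.Carrier) : Set (J → S.Carrier) :=
  {u' | u' ∘ f = u ∘ f ∧ EqType A u' u}

theorem self_mem_conjugates (f : I → J) (u : J → S.Carrier) : u ∈ conjugates A f u :=
  ⟨rfl, .refl u⟩

/-- Any n distinct conjugates, strung together with the base `u ∘ f`, form one finite tuple. Moving
it to the base `u' ∘ f` keeps the entries' equalities and inequalities, so it yields n distinct
conjugates of `u'`. -/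
theorem CompactOver.encard_conjugates_le (hS : CompactOver A S) [Finite I] [Finite J]
    {f : I → J} {u u' : J → S.Carrier} (h : EqType A u u') :
    (conjugates A f u).encard ≤ (conjugates A f u').encard := by
  refine ENat.forall_natCast_le_iff_le.1 fun n hn => ?_
  obtain ⟨t, ht, htn⟩ := Set.exists_subset_encard_eq hn
  have htf : t.Finite := Set.finite_of_encard_eq_coe htn
  obtain ⟨e⟩ : Nonempty (Fin n ≃ t) := by
    have : Finite t := htf
    refine ⟨(Finite.equivFinOfCardEq ?_).symm⟩
    rw [Nat.card_coe_set_eq, Set.ncard_def, htn, ENat.toNat_natCast]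
  let w : I ⊕ (Fin n × J) → S.Carrier := Sum.elim (u ∘ f) fun p => (e p.1).1 p.2
  obtain ⟨w', hw', hww⟩ := hS.exists_extension (f := (Sum.inl : I → I ⊕ (Fin n × J)))
    Sum.inl_injective (u := w) (v := u' ∘ f)
    (show EqType A (w ∘ Sum.inl) (u' ∘ f) from h.comp f)
  let g : Fin n → (J → S.Carrier) := fun i j => w' (Sum.inr (i, j))
  have hg : Function.Injective g := by
    intro i j hij
    refine e.injective (Subtype.ext (funext fun k => ?_))
    exact (hww.apply_eq_iff (Sum.inr (i, k)) (Sum.inr (j, k))).1 (congrFun hij k)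
  have hgm : ∀ i, g i ∈ conjugates A f u' := by
    intro i
    refine ⟨?_, ((hww.comp fun j => Sum.inr (i, j)).trans (ht (e i).2).2).trans h⟩
    funext k
    have h1 : w (Sum.inr (i, f k)) = w (Sum.inl k) := congrFun (ht (e i).2).1 k
    exact ((hww.apply_eq_iff _ _).2 h1).trans (congrFun hw' k)
  have : (Set.univ : Set (Fin n)).encard = n := by simp
  rw [← this, ← hg.encard_image]
  exact Set.encard_le_encard (Set.image_subset_iff.2 fun i _ => hgm i)

theorem CompactOver.encard_conjugates_eq (hS : CompactOver A S) [Finite I] [Finite J]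
    {f : I → J} {u u' : J → S.Carrier} (h : EqType A u u') :
    (conjugates A f u).encard = (conjugates A f u').encard :=
  (hS.encard_conjugates_le h).antisymm (hS.encard_conjugates_le h.symm)

theorem CompactOver.finite_conjugates (hS : CompactOver A S) [Finite I] [Finite J]
    {f : I → J} {u u' : J → S.Carrier} (h : EqType A u u') (hu : (conjugates A f u).Finite) :
    (conjugates A f u').Finite := by
  rw [← Set.encard_lt_top_iff] at hu ⊢
  exact (hS.encard_conjugates_le h.symm).trans_lt hu

theorem CompactOver.ncard_conjugates_eq (hS : CompactOver A S) [Finite I] [Finite J]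
    {f : I → J} {u u' : J → S.Carrier} (h : EqType A u u') :
    (conjugates A f u).ncard = (conjugates A f u').ncard := by
  rw [Set.ncard_def, Set.ncard_def, hS.encard_conjugates_eq h]

theorem conjugates_inter_preimage {f : I → J} {g : J → K} {u u' : K → S.Carrier}
    (h : u' ∈ conjugates A (g ∘ f) u) :
    conjugates A (g ∘ f) u ∩ (fun x => x ∘ g) ⁻¹' {u' ∘ g} = conjugates A g u' := by
  ext x
  constructor
  · rintro ⟨h1, h2⟩
    exact ⟨h2, h1.2.trans h.2.symm⟩
  · rintro ⟨h1, h2⟩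
    exact ⟨⟨(congrArg (· ∘ f) h1).trans h.1, h2.trans h.2⟩, h1⟩

theorem CompactOver.image_conjugates (hS : CompactOver A S) [Finite J] [Finite K]
    {f : I → J} {g : J → K} (hg : Function.Injective g) (u : K → S.Carrier) :
    (fun x => x ∘ g) '' conjugates A (g ∘ f) u = conjugates A f (u ∘ g) := by
  ext x
  constructor
  · rintro ⟨y, hy, rfl⟩
    exact ⟨hy.1, hy.2.comp g⟩
  · intro hx
    obtain ⟨y, rfl, hy⟩ := hS.exists_extension hg hx.2.symm
    exact ⟨y, ⟨hx.1, hy⟩, rfl⟩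

theorem CompactOver.finite_conjugates_comp (hS : CompactOver A S) [Finite J] [Finite K]
    {f : I → J} {g : J → K} (hg : Function.Injective g) {u : K → S.Carrier}
    (h1 : (conjugates A f (u ∘ g)).Finite) (h2 : (conjugates A g u).Finite) :
    (conjugates A (g ∘ f) u).Finite := by
  refine Set.Finite.of_finite_fibers (fun x => x ∘ g) ?_ ?_
  · rwa [hS.image_conjugates hg]
  · rintro _ ⟨u', hu', rfl⟩
    rw [conjugates_inter_preimage hu']
    exact hS.finite_conjugates hu'.2.symm h2

/-- Tower law: restriction along `g` maps onto the conjugates of the intermediate tuple, and its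
fibres, being sets of conjugates of tuples of equal type, all have the same size. -/
theorem CompactOver.ncard_conjugates_comp (hS : CompactOver A S) [Finite J] [Finite K]
    {f : I → J} {g : J → K} (hg : Function.Injective g) {u : K → S.Carrier}
    (h : (conjugates A (g ∘ f) u).Finite) :
    (conjugates A (g ∘ f) u).ncard = (conjugates A f (u ∘ g)).ncard * (conjugates A g u).ncard := by
  classical
  have himg := hS.image_conjugates (f := f) hg u
  have hfin : (conjugates A f (u ∘ g)).Finite := by rw [← himg]; exact h.image _
  rw [Set.ncard_eq_toFinset_card _ h, Set.ncard_eq_toFinset_card _ hfin,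
    Finset.card_eq_sum_card_fiberwise (f := fun x => x ∘ g) (t := hfin.toFinset)]
  · rw [← smul_eq_mul, ← Finset.sum_const]
    refine Finset.sum_congr rfl fun y hy => ?_
    rw [Set.Finite.mem_toFinset, ← himg] at hy
    obtain ⟨u', hu', rfl⟩ := hy
    rw [← hS.ncard_conjugates_eq hu'.2, ← conjugates_inter_preimage hu', ← Set.ncard_coe_finset]
    congr 1
    ext x
    simp
  · intro x hx
    simp only [Set.Finite.coe_toFinset] at hx ⊢
    rw [← himg]
    exact ⟨x, hx, rfl⟩

end EqType

/-! ### Algebraicity and degrees. -/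

/-- `y` is algebraic over `A` and `x`: it has finitely many conjugates. -/
def IsAlgOver (A : Set (Imag L M)) (x y : S.Carrier) : Prop :=
  (conjugates A (![0] : Fin 1 → Fin 2) ![x, y]).Finite

/-- The number of conjugates of `y` over `A` and `x`. -/
noncomputable def degreeOver (A : Set (Imag L M)) (x y : S.Carrier) : ℕ :=
  (conjugates A (![0] : Fin 1 → Fin 2) ![x, y]).ncard

/-- `x` and `y` are interalgebraic over `A`. -/
def Interalg (A : Set (Imag L M)) (x y : S.Carrier) : Prop := IsAlgOver A x y ∧ IsAlgOver A y x

theorem Interalg.symm {x y : S.Carrier} (h : Interalg A x y) : Interalg A y x := ⟨h.2, h.1⟩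

theorem EqType.single {x y : S.Carrier} {I : Type} {v v' : I → S.Carrier} (h : EqType A v v')
    {i : I} (hx : v i = x) (hy : v' i = y) : EqType A ![x] ![y] := by
  have := h.comp (![i] : Fin 1 → I)
  have e : ∀ v : I → S.Carrier, v ∘ (![i] : Fin 1 → I) = ![v i] := fun v => by
    funext k; fin_cases k; rfl
  rwa [e, e, hx, hy] at this

theorem comp_pair {I : Type} (v : I → S.Carrier) (i j : I) :
    v ∘ (![i, j] : Fin 2 → I) = ![v i, v j] := by
  funext k; fin_cases k <;> rfl

theorem comp_singleton {I : Type} (v : I → S.Carrier) (i : I) :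
    v ∘ (![i] : Fin 1 → I) = ![v i] := by
  funext k; fin_cases k; rfl

theorem singleton_injective {I : Type} (i : I) : Function.Injective (![i] : Fin 1 → I) :=
  Function.injective_of_subsingleton _

theorem pair_injective {I : Type} {i j : I} (h : i ≠ j) :
    Function.Injective (![i, j] : Fin 2 → I) := by
  intro a b hab
  fin_cases a <;> fin_cases b <;> simp_all

theorem pair_comp_zero {I : Type} (i j : I) :
    (![i, j] : Fin 2 → I) ∘ (![0] : Fin 1 → Fin 2) = ![i] := by
  funext k; fin_cases k; rfl

theorem EqType.swap {x y x' y' : S.Carrier} (h : EqType A ![x, y] ![x', y']) :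
    EqType A ![y, x] ![y', x'] := by
  have := h.comp ![1, 0]
  rwa [comp_pair, comp_pair] at this

theorem conjugates_pair_eq (x y : S.Carrier) :
    conjugates A (![0] : Fin 1 → Fin 2) ![x, y] =
      (fun y' => ![x, y']) '' {y' | EqType A ![x, y'] ![x, y]} := by
  ext u
  constructor
  · rintro ⟨h1, h2⟩
    have h3 : u 0 = x := congrFun h1 0
    have h4 : ![x, u 1] = u := by
      funext k; fin_cases k
      exacts [h3.symm, rfl]
    exact ⟨u 1, by rw [Set.mem_ofPred_eq, h4]; exact h2, h4⟩
  · rintro ⟨y', h, rfl⟩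
    exact ⟨by rw [comp_singleton, comp_singleton]; rfl, h⟩

theorem cons_pair_injective (x : S.Carrier) : Function.Injective fun y' : S.Carrier => ![x, y'] :=
  fun _ _ h => congrFun h 1

theorem isAlgOver_iff {x y : S.Carrier} :
    IsAlgOver A x y ↔ {y' | EqType A ![x, y'] ![x, y]}.Finite := by
  rw [IsAlgOver, conjugates_pair_eq, Set.finite_image_iff (cons_pair_injective x).injOn]

theorem degreeOver_eq (x y : S.Carrier) :
    degreeOver A x y = {y' | EqType A ![x, y'] ![x, y]}.ncard := by
  rw [degreeOver, conjugates_pair_eq, (cons_pair_injective x).injOn.ncard_image]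

theorem IsAlgOver.degreeOver_pos {x y : S.Carrier} (h : IsAlgOver A x y) :
    0 < degreeOver A x y :=
  (Set.ncard_pos h).2 ⟨_, self_mem_conjugates _ _⟩

theorem CompactOver.isAlgOver_of_eqType (hS : CompactOver A S) {x y x' y' : S.Carrier}
    (h : EqType A ![x, y] ![x', y']) (hxy : IsAlgOver A x y) : IsAlgOver A x' y' :=
  hS.finite_conjugates h hxy

theorem CompactOver.degreeOver_eq_of_eqType (hS : CompactOver A S) {x y x' y' : S.Carrier}
    (h : EqType A ![x, y] ![x', y']) : degreeOver A x y = degreeOver A x' y' :=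
  hS.ncard_conjugates_eq h

theorem finite_conjugates_of_pairwise {K : Type} [Finite K] {u : K → S.Carrier} {i : K}
    (h : ∀ j, IsAlgOver A (u i) (u j)) : (conjugates A (![i] : Fin 1 → K) u).Finite := by
  refine (Set.Finite.pi' fun j => isAlgOver_iff.1 (h j)).subset ?_
  rintro u' ⟨h1, h2⟩ j
  have h3 : u' i = u i := congrFun h1 0
  have := h2.comp ![i, j]
  rwa [comp_pair, comp_pair, h3] at this

theorem conjugates_subset {I J K : Type} {f : I → K} {g : J → I} (u : K → S.Carrier) :
    conjugates A f u ⊆ conjugates A (f ∘ g) u :=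
  fun _ h => ⟨congrArg (· ∘ g) h.1, h.2⟩

theorem CompactOver.ncard_conjugates_eq_degree_mul (hS : CompactOver A S) {K : Type} [Finite K]
    {u : K → S.Carrier} {i j : K} (hij : i ≠ j) (h : ∀ k, IsAlgOver A (u i) (u k)) :
    (conjugates A (![i] : Fin 1 → K) u).ncard =
      degreeOver A (u i) (u j) * (conjugates A (![i, j] : Fin 2 → K) u).ncard := by
  have h1 := finite_conjugates_of_pairwise h
  rw [← pair_comp_zero i j] at h1 ⊢
  rw [hS.ncard_conjugates_comp (pair_injective hij) h1, comp_pair]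
  rfl

theorem conjugates_pair_swap {K : Type} (u : K → S.Carrier) (i j : K) :
    conjugates A (![i, j] : Fin 2 → K) u = conjugates A (![j, i] : Fin 2 → K) u := by
  ext x
  refine and_congr_left fun _ => ?_
  rw [comp_pair, comp_pair, comp_pair, comp_pair]
  simp [and_comm]

theorem Interalg.refl (x : S.Carrier) : Interalg A x x := by
  have : IsAlgOver A x x := isAlgOver_iff.2 ((Set.finite_singleton x).subset fun y hy =>
    ((EqType.apply_eq_iff hy 0 1).2 rfl).symm)
  exact ⟨this, this⟩

/-- By the tower law, the number of conjugates of the triple over one entry factors through either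
of the other two entries. Multiplying the three resulting equations, the counts over pairs cancel:
they are positive and do not depend on the order of the pair. -/
theorem CompactOver.degreeOver_cocycle (hS : CompactOver A S) {x y z : S.Carrier}
    (hxy : Interalg A x y) (hyz : Interalg A y z) (hxz : Interalg A x z) :
    degreeOver A x y * degreeOver A y z * degreeOver A z x =
      degreeOver A y x * degreeOver A z y * degreeOver A x z := by
  have h0 : ∀ k, IsAlgOver A x (![x, y, z] k) := by
    intro k; fin_cases k
    exacts [(Interalg.refl x).1, hxy.1, hxz.1]
  have h1 : ∀ k, IsAlgOver A y (![x, y, z] k) := by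
    intro k; fin_cases k
    exacts [hxy.2, (Interalg.refl y).1, hyz.1]
  have h2 : ∀ k, IsAlgOver A z (![x, y, z] k) := by
    intro k; fin_cases k
    exacts [hxz.2, hyz.2, (Interalg.refl z).1]
  have pos : ∀ i j : Fin 3, (conjugates A (![i] : Fin 1 → Fin 3) ![x, y, z]).Finite →
      0 < (conjugates A (![i, j] : Fin 2 → Fin 3) ![x, y, z]).ncard := by
    intro i j h
    rw [← pair_comp_zero i j] at h
    exact (Set.ncard_pos (h.subset (conjugates_subset _))).2 ⟨_, self_mem_conjugates _ _⟩
  have p01 := pos 0 1 (finite_conjugates_of_pairwise h0)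
  have p12 := pos 1 2 (finite_conjugates_of_pairwise h1)
  have p20 := pos 2 0 (finite_conjugates_of_pairwise h2)
  have e0 := (hS.ncard_conjugates_eq_degree_mul (u := ![x, y, z]) (i := 0) (j := 1)
    (by decide) h0).symm.trans
    (hS.ncard_conjugates_eq_degree_mul (u := ![x, y, z]) (i := 0) (j := 2) (by decide) h0)
  have e1 := (hS.ncard_conjugates_eq_degree_mul (u := ![x, y, z]) (i := 1) (j := 2)
    (by decide) h1).symm.trans
    (hS.ncard_conjugates_eq_degree_mul (u := ![x, y, z]) (i := 1) (j := 0) (by decide) h1)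
  have e2 := (hS.ncard_conjugates_eq_degree_mul (u := ![x, y, z]) (i := 2) (j := 0)
    (by decide) h2).symm.trans
    (hS.ncard_conjugates_eq_degree_mul (u := ![x, y, z]) (i := 2) (j := 1) (by decide) h2)
  rw [conjugates_pair_swap _ 0 2] at e0
  rw [conjugates_pair_swap _ 1 0] at e1
  rw [conjugates_pair_swap _ 2 1] at e2
  simp only [Matrix.cons_val_zero, Matrix.cons_val_one, Matrix.cons_val] at e0 e1 e2
  refine Nat.eq_of_mul_eq_mul_right (Nat.mul_pos (Nat.mul_pos p01 p12) p20) ?_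
  calc _ = (degreeOver A x y * (conjugates A ![0, 1] ![x, y, z]).ncard) *
        (degreeOver A y z * (conjugates A ![1, 2] ![x, y, z]).ncard) *
        (degreeOver A z x * (conjugates A ![2, 0] ![x, y, z]).ncard) := by ring
    _ = _ := by rw [e0, e1, e2]; ring

/-- The whole triple has finitely many conjugates over `x` by the tower argument; project them to
the pair (x, z). -/
theorem CompactOver.isAlgOver_trans (hS : CompactOver A S) {x y z : S.Carrier}
    (hxy : IsAlgOver A x y) (hyz : IsAlgOver A y z) : IsAlgOver A x z := by
  have h1 : (conjugates A (![0, 1] : Fin 2 → Fin 3) ![x, y, z]).Finite := by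
    refine (Set.Finite.image (fun z' => ![x, y, z']) (isAlgOver_iff.1 hyz)).subset ?_
    rintro u ⟨h1, h2⟩
    have h0 : u 0 = x := congrFun h1 0
    have h1 : u 1 = y := congrFun h1 1
    refine ⟨u 2, ?_, ?_⟩
    · have := h2.comp ![1, 2]
      rwa [comp_pair, comp_pair, h1] at this
    · funext k; fin_cases k
      exacts [h0.symm, h1.symm, rfl]
  have h2 := hS.finite_conjugates_comp (f := (![0] : Fin 1 → Fin 2))
    (pair_injective (by decide : (0 : Fin 3) ≠ 1)) (u := ![x, y, z])
    (by rw [comp_pair]; exact hxy) h1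
  rw [pair_comp_zero, ← pair_comp_zero 0 2] at h2
  have h3 := h2.image fun u => u ∘ ![0, 2]
  rw [hS.image_conjugates (pair_injective (by decide : (0 : Fin 3) ≠ 2)), comp_pair] at h3
  exact h3

theorem CompactOver.interalg_trans (hS : CompactOver A S) {x y z : S.Carrier}
    (hxy : Interalg A x y) (hyz : Interalg A y z) : Interalg A x z :=
  ⟨hS.isAlgOver_trans hxy.1 hyz.1, hS.isAlgOver_trans hyz.2 hxy.2⟩

theorem CompactOver.exists_extension_pair (hS : CompactOver A S) {x y x' : S.Carrier}
    (h : EqType A ![x] ![x']) : ∃ y', EqType A ![x', y'] ![x, y] := by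
  obtain ⟨u, h1, h2⟩ := hS.exists_extension (u := ![x, y]) (v := ![x'])
    (singleton_injective (0 : Fin 2)) (by rw [comp_singleton]; exact h)
  refine ⟨u 1, ?_⟩
  have h3 : u 0 = x' := congrFun h1 0
  have h4 : ![x', u 1] = u := by
    funext k; fin_cases k
    exacts [h3.symm, rfl]
  rwa [h4]

/-! ### Bounding the fibres of an algebraic relation uniformly. -/

/-- The tuples `(a, b₁, …, bₘ)` with distinct `bᵢ` such that all `(a, bᵢ)` lie in `D`. -/
def fibreTuples (m : ℕ) (D : Set (Fin 2 → S.Carrier)) : Set (Option (Fin m) → S.Carrier) :=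
  {u | Function.Injective (u ∘ some)} ∩ ⋂ i : Fin m, {u | u ∘ ![none, some i] ∈ D}

theorem tupleDef_fibreTuples (m : ℕ) {D : Set (Fin 2 → S.Carrier)} (hD : TupleDef A (Fin 2) D) :
    TupleDef A _ (fibreTuples m D) :=
  (tupleDef_injective_comp _).inter (TupleDef.iInter fun _ => hD.comap _)

theorem exists_mem_fibreTuples {m : ℕ} {D : Set (Fin 2 → S.Carrier)} {a : S.Carrier}
    (h : (m : ℕ∞) ≤ {b | ![a, b] ∈ D}.encard) :
    ∃ u ∈ fibreTuples m D, u ∘ (![none] : Fin 1 → _) = ![a] := by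
  obtain ⟨t, ht, htn⟩ := Set.exists_subset_encard_eq h
  obtain ⟨e⟩ : Nonempty (Fin m ≃ t) := by
    have : Finite t := Set.finite_of_encard_eq_coe htn
    refine ⟨(Finite.equivFinOfCardEq ?_).symm⟩
    rw [Nat.card_coe_set_eq, Set.ncard_def, htn, ENat.toNat_natCast]
  refine ⟨fun o => o.elim a fun i => (e i).1, ⟨?_, ?_⟩, comp_singleton _ _⟩
  · exact fun i j h => e.injective (Subtype.ext h)
  · refine Set.mem_iInter.2 fun i => ?_
    rw [Set.mem_ofPred_eq, comp_pair]
    exact ht (e i).2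

theorem le_encard_of_mem_fibreTuples {m : ℕ} {D : Set (Fin 2 → S.Carrier)} {a : S.Carrier}
    {u : Option (Fin m) → S.Carrier} (hu : u ∈ fibreTuples m D)
    (ha : u ∘ (![none] : Fin 1 → _) = ![a]) : (m : ℕ∞) ≤ {b | ![a, b] ∈ D}.encard := by
  have : (Set.univ : Set (Fin m)).encard = m := by simp
  rw [← this, ← hu.1.encard_image]
  refine Set.encard_le_encard (Set.image_subset_iff.2 fun i _ => ?_)
  have h := Set.mem_iInter.1 hu.2 i
  have h0 : u none = a := congrFun ha 0
  rw [Set.mem_ofPred_eq, comp_pair, h0] at h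
  exact h

/-- An algebraic element lies in a definable set with uniformly bounded fibres. -/
theorem CompactOver.exists_bounded (hS : CompactOver A S) {x y : S.Carrier}
    (h : IsAlgOver A x y) : ∃ D : Set (Fin 2 → S.Carrier), TupleDef A (Fin 2) D ∧ ![x, y] ∈ D ∧
      ∃ n : ℕ, ∀ a, {b | ![a, b] ∈ D}.encard ≤ n := by
  set n := {y' | EqType A ![x, y'] ![x, y]}.ncard with hn
  have hfin := isAlgOver_iff.1 h
  obtain ⟨D, hD, hxy, hx⟩ : ∃ D, TupleDef A (Fin 2) D ∧ ![x, y] ∈ D ∧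
      ¬ ∃ u ∈ fibreTuples (n + 1) D, u ∘ (![none] : Fin 1 → _) = ![x] := by
    -- Otherwise compactness gives n + 1 distinct elements b with (x, b) in every `A`-definable set
    -- containing (x, y), that is, n + 1 conjugates of `y` over `x`.
    by_contra! hcon
    obtain ⟨u, hu, huD⟩ : ∃ u : Option (Fin (n + 1)) → S.Carrier, u ∘ ![none] = ![x] ∧
        ∀ X ∈ (fun D => fibreTuples (n + 1) D) '' {D | TupleDef A (Fin 2) D ∧ ![x, y] ∈ D},
          u ∈ X := by
      refine hS (![none] : Fin 1 → Option (Fin (n + 1))) (singleton_injective _) ![x] _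
        ⟨_, _, ⟨.univ, trivial⟩, rfl⟩ ?_ ?_ ?_
      · rintro _ ⟨D, hD, rfl⟩
        exact tupleDef_fibreTuples _ hD.1
      · rintro _ ⟨D, hD, rfl⟩ _ ⟨E, hE, rfl⟩
        refine ⟨_, ⟨D ∩ E, ⟨hD.1.inter hE.1, hD.2, hE.2⟩, rfl⟩, fun u hu => ?_⟩
        have := Set.mem_iInter.1 hu.2
        exact ⟨⟨hu.1, Set.mem_iInter.2 fun i => (this i).1⟩,
          ⟨hu.1, Set.mem_iInter.2 fun i => (this i).2⟩⟩
      · rintro _ ⟨D, hD, rfl⟩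
        exact hcon D hD.1 hD.2
    have hle : ((n + 1 : ℕ) : ℕ∞) ≤ {y' | EqType A ![x, y'] ![x, y]}.encard := by
      have := le_encard_of_mem_fibreTuples (D := {v | EqType A v ![x, y]}) (u := u) (a := x)
        ⟨(huD _ ⟨_, ⟨.univ, trivial⟩, rfl⟩).1, Set.mem_iInter.2 fun i X hX => ?_⟩ hu
      · exact this
      · have key : ∀ Y, TupleDef A (Fin 2) Y → ![x, y] ∈ Y → u ∘ ![none, some i] ∈ Y :=
          fun Y hY h => Set.mem_iInter.1 (huD _ ⟨Y, ⟨hY, h⟩, rfl⟩).2 i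
        exact ⟨fun h1 => by_contra fun h2 => key _ hX.compl h2 h1, key X hX⟩
    rw [← hfin.cast_ncard_eq, ← hn] at hle
    exact absurd (Nat.cast_le.1 hle) (by lia)
  -- Having more than n points in the fibre is an `A`-definable condition on the first coordinate,
  -- and it fails at `x`; the bad first coordinates can be deleted.
  refine ⟨D \ {v | v ∘ (![0] : Fin 1 → Fin 2) ∈ (fun u => u ∘ ![none]) '' fibreTuples (n + 1) D},
    hD.diff (((tupleDef_fibreTuples _ hD).map (singleton_injective _)).comap _),
    ⟨hxy, ?_⟩, n, fun a => ?_⟩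
  · rintro ⟨u, hu, hux⟩
    exact hx ⟨u, hu, hux.trans (comp_singleton _ _)⟩
  · by_contra! hlt
    have hle : ((n + 1 : ℕ) : ℕ∞) ≤ {b | ![a, b] ∈ D}.encard :=
      ((ENat.natCast_add_one_le_iff.2 hlt).trans (Set.encard_le_encard fun b hb => hb.1) :)
    obtain ⟨b, hb⟩ := Set.nonempty_of_encard_ne_zero (ne_bot_of_gt hlt)
    refine hb.2 ?_
    rw [Set.mem_ofPred_eq, comp_singleton]
    exact exists_mem_fibreTuples hle

/-! ### Morley rank of definable sets: unions and finite-to-finite images. -/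

/-- `X` contains infinitely many pairwise disjoint definable sets of Morley rank at least `β`. -/
def HasDisjointFamily (X : Set S.Carrier) (β : Ordinal.{w}) : Prop :=
  ∃ Y : ℕ → Set S.Carrier,
    (∀ i, DefinableOver (Set.univ : Set (Imag L M)) S.toEq (Y i)) ∧ (∀ i, Y i ⊆ X) ∧
    (∀ i j, i ≠ j → Disjoint (Y i) (Y j)) ∧ ∀ i, MorleyRankGe (Y i) β

theorem morleyRankGe_iff {X : Set S.Carrier} {α : Ordinal.{w}} :
    MorleyRankGe X α ↔ X.Nonempty ∧ ∀ β < α, HasDisjointFamily X β := by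
  rw [MorleyRankGe]
  rfl

theorem HasDisjointFamily.mono {X Y : Set S.Carrier} {β : Ordinal.{w}}
    (h : HasDisjointFamily X β) (hXY : X ⊆ Y) : HasDisjointFamily Y β := by
  obtain ⟨Z, h1, h2, h3⟩ := h
  exact ⟨Z, h1, fun i => (h2 i).trans hXY, h3⟩

theorem MorleyRankGe.mono {X Y : Set S.Carrier} {α : Ordinal.{w}} (h : MorleyRankGe X α)
    (hXY : X ⊆ Y) : MorleyRankGe Y α := by
  rw [morleyRankGe_iff] at h ⊢
  exact ⟨h.1.mono hXY, fun β hβ => (h.2 β hβ).mono hXY⟩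

theorem MorleyRankGe.anti {X : Set S.Carrier} {α β : Ordinal.{w}} (h : MorleyRankGe X α)
    (hβ : β ≤ α) : MorleyRankGe X β := by
  rw [morleyRankGe_iff] at h ⊢
  exact ⟨h.1, fun γ hγ => h.2 γ (hγ.trans_le hβ)⟩

theorem HasDisjointFamily.anti {X : Set S.Carrier} {α β : Ordinal.{w}}
    (h : HasDisjointFamily X α) (hβ : β ≤ α) : HasDisjointFamily X β := by
  obtain ⟨Z, h1, h2, h3, h4⟩ := h
  exact ⟨Z, h1, h2, h3, fun i => (h4 i).anti hβ⟩

theorem MorleyRankGe.nonempty {X : Set S.Carrier} {α : Ordinal.{w}} (h : MorleyRankGe X α) :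
    X.Nonempty := (morleyRankGe_iff.1 h).1

theorem HasDisjointFamily.of_infinite {X : Set S.Carrier} {β : Ordinal.{w}}
    {Y : ℕ → Set S.Carrier}
    (hY : ∀ i, DefinableOver (Set.univ : Set (Imag L M)) S.toEq (Y i)) (hX : ∀ i, Y i ⊆ X)
    (hd : ∀ i j, i ≠ j → Disjoint (Y i) (Y j)) (h : {i | MorleyRankGe (Y i) β}.Infinite) :
    HasDisjointFamily X β := by
  let e := h.natEmbedding
  refine ⟨fun i => Y (e i), fun i => hY _, fun i => hX _, fun i j hij => hd _ _ fun h => ?_,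
    fun i => (e i).2⟩
  exact hij (e.injective (Subtype.ext h))

/-- By induction each member of a disjoint family in the union keeps its rank on one of the two
sides, and one side is chosen infinitely often. -/
theorem MorleyRankGe.of_union {X Y : Set S.Carrier}
    (hX : DefinableOver (Set.univ : Set (Imag L M)) S.toEq X)
    (hY : DefinableOver (Set.univ : Set (Imag L M)) S.toEq Y) {α : Ordinal.{w}}
    (h : MorleyRankGe (X ∪ Y) α) : MorleyRankGe X α ∨ MorleyRankGe Y α := by
  induction α using WellFoundedLT.induction generalizing X Y with
  | ind α ih =>
    have key : ∀ β < α, HasDisjointFamily X β ∨ HasDisjointFamily Y β := by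
      intro β hβ
      obtain ⟨Z, hZ, hZXY, hd, hr⟩ := (morleyRankGe_iff.1 h).2 β hβ
      have hor : ∀ i, MorleyRankGe (Z i ∩ X) β ∨ MorleyRankGe (Z i ∩ Y) β := fun i => by
        refine ih β hβ ((hZ i).inter hX) ((hZ i).inter hY) ((hr i).mono fun z hz => ?_)
        rcases hZXY i hz with h | h
        exacts [Or.inl ⟨hz, h⟩, Or.inr ⟨hz, h⟩]
      have hinf : ({i | MorleyRankGe (Z i ∩ X) β} ∪ {i | MorleyRankGe (Z i ∩ Y) β}).Infinite := by
        have huniv : {i | MorleyRankGe (Z i ∩ X) β} ∪ {i | MorleyRankGe (Z i ∩ Y) β} = Set.univ :=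
          Set.eq_univ_iff_forall.2 hor
        rw [huniv]
        exact Set.infinite_univ
      rcases Set.infinite_union.1 hinf with h | h
      · exact .inl (.of_infinite (fun i => (hZ i).inter hX) (fun i => Set.inter_subset_right)
          (fun i j hij => (hd i j hij).mono Set.inter_subset_left Set.inter_subset_left) h)
      · exact .inr (.of_infinite (fun i => (hZ i).inter hY) (fun i => Set.inter_subset_right)
          (fun i j hij => (hd i j hij).mono Set.inter_subset_left Set.inter_subset_left) h)
    -- For α = 0 there is no family to witness that a side is non-empty.
    rcases eq_or_ne α 0 with rfl | hα
    · simp only [morleyRankGe_iff, not_lt_zero, IsEmpty.forall_iff, implies_true, and_true]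
      exact Set.union_nonempty.1 h.nonempty
    have hne : ∀ {V : Set S.Carrier} {β : Ordinal.{w}}, HasDisjointFamily V β → V.Nonempty := by
      rintro V β ⟨Z, -, hZ, -, hr⟩
      exact (hr 0).nonempty.mono (hZ 0)
    have hpos : 0 < α := pos_iff_ne_zero.2 hα
    by_cases hx : ∀ β < α, HasDisjointFamily X β
    · exact .inl (morleyRankGe_iff.2 ⟨hne (hx 0 hpos), hx⟩)
    · push Not at hx
      obtain ⟨γ, hγ, hγX⟩ := hx
      -- The side found in `key` may vary with β. Since `X` already fails at γ, it fails at every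
      -- larger rank, so `Y` works at max β γ and hence at β.
      have hy : ∀ β < α, HasDisjointFamily Y β := fun β hβ =>
        ((key (max β γ) (max_lt hβ hγ)).resolve_left fun h =>
          hγX (h.anti (le_max_right _ _))).anti (le_max_left _ _)
      exact .inr (morleyRankGe_iff.2 ⟨hne (hy 0 hpos), hy⟩)

theorem MorleyRankGe.of_union_finset {ι : Type*} {X : Set S.Carrier} {V : ι → Set S.Carrier}
    (hX : DefinableOver (Set.univ : Set (Imag L M)) S.toEq X) (s : Finset ι)
    (hV : ∀ i ∈ s, DefinableOver (Set.univ : Set (Imag L M)) S.toEq (V i)) {α : Ordinal.{w}}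
    (h : MorleyRankGe (X ∪ ⋃ i ∈ s, V i) α) (hn : ∀ i ∈ s, ¬ MorleyRankGe (V i) α) :
    MorleyRankGe X α := by
  classical
  induction s using Finset.induction_on with
  | empty => simpa using h
  | insert i s _ ih =>
    have hV' : ∀ j ∈ s, DefinableOver (Set.univ : Set (Imag L M)) S.toEq (V j) :=
      fun j hj => hV j (by simp [hj])
    rw [Finset.set_biUnion_insert, Set.union_left_comm] at h
    exact ih hV' ((MorleyRankGe.of_union (hV i (by simp))
      (hX.union (.finset_union s hV')) h).resolve_left (hn i (by simp)))
      fun j hj => hn j (by simp [hj])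

/-- Disjointness can be weakened to bounded multiplicity. Either infinitely many members meet a
fixed one in large rank, and restricting to it lowers the multiplicity, or a subsequence has small
pairwise intersections and can be disjointified without loss of rank. -/
theorem HasDisjointFamily.of_bounded_overlap {Z : Set S.Carrier} {β : Ordinal.{w}} (n : ℕ)
    {Y : ℕ → Set S.Carrier}
    (hY : ∀ i, DefinableOver (Set.univ : Set (Imag L M)) S.toEq (Y i)) (hZ : ∀ i, Y i ⊆ Z)
    (hr : ∀ i, MorleyRankGe (Y i) β) (hn : ∀ z, {i | z ∈ Y i}.encard ≤ n) :
    HasDisjointFamily Z β := by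
  induction n generalizing Y with
  | zero =>
    obtain ⟨z, hz⟩ := (hr 0).nonempty
    have := hn z
    simp only [Nat.cast_zero, nonpos_iff_eq_zero, Set.encard_eq_zero] at this
    exact absurd hz (Set.eq_empty_iff_forall_notMem.1 this 0)
  | succ n ih =>
    by_cases hc : ∃ i, {j | MorleyRankGe (Y i ∩ Y j) β}.Infinite
    · obtain ⟨i, hi⟩ := hc
      -- Index i is left out so that, at points of `Y i`, it accounts for one unit of the bound n +
      -- 1 not used by the new family.
      have hi' : ({j | MorleyRankGe (Y i ∩ Y j) β} \ {i}).Infinite :=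
        hi.sdiff (Set.finite_singleton i)
      let e := hi'.natEmbedding
      refine ih (Y := fun k => Y i ∩ Y (e k)) (fun k => (hY i).inter (hY _))
        (fun k => Set.inter_subset_left.trans (hZ i)) (fun k => (e k).2.1) fun z => ?_
      by_cases hz : z ∈ Y i
      · have hinj : Function.Injective fun k => (e k : ℕ) :=
          Subtype.val_injective.comp e.injective
        rw [← hinj.encard_image]
        have hsub : insert i ((fun k => (e k : ℕ)) '' {k | z ∈ Y i ∩ Y (e k)}) ⊆
            {j | z ∈ Y j} := by
          rintro _ (rfl | ⟨k, hk, rfl⟩)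
          exacts [hz, hk.2]
        have hnot : i ∉ (fun k => (e k : ℕ)) '' {k | z ∈ Y i ∩ Y (e k)} := by
          rintro ⟨k, -, hk⟩
          exact (e k).2.2 hk
        have := (Set.encard_le_encard hsub).trans (hn z)
        rw [Set.encard_insert_of_notMem hnot, Nat.cast_add, Nat.cast_one] at this
        exact (ENat.add_le_add_iff_right ENat.one_ne_top).1 this
      · simp [hz]
    · push Not at hc
      obtain ⟨f, -, hf⟩ := exists_seq_of_forall_finset_exists (fun _ : ℕ => True)
        (fun i j => i ≠ j ∧ ¬ MorleyRankGe (Y i ∩ Y j) β) fun s _ => by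
          have hfin : ((s : Set ℕ) ∪ ⋃ i ∈ s, {j | MorleyRankGe (Y i ∩ Y j) β}).Finite :=
            s.finite_toSet.union (s.finite_toSet.biUnion fun i _ => hc i)
          obtain ⟨j, hj⟩ := hfin.exists_notMem
          refine ⟨j, trivial, fun i hi => ⟨fun h => hj (.inl (h ▸ hi)), fun h => hj (.inr ?_)⟩⟩
          exact Set.mem_biUnion hi h
      have hdef : ∀ k, DefinableOver (Set.univ : Set (Imag L M)) S.toEq
          (⋃ j ∈ Finset.range k, Y (f j)) := fun k => .finset_union _ fun j _ => hY _
      refine ⟨fun k => Y (f k) \ ⋃ j ∈ Finset.range k, Y (f j), fun k => (hY _).diff (hdef k),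
        fun k => Set.sdiff_subset.trans (hZ _), ?_, fun k => ?_⟩
      · have hlt : ∀ i j, i < j → Disjoint (Y (f i) \ ⋃ l ∈ Finset.range i, Y (f l))
            (Y (f j) \ ⋃ l ∈ Finset.range j, Y (f l)) := fun i j hij =>
          Set.disjoint_left.2 fun z hz hz' =>
            hz'.2 (Set.mem_biUnion (Finset.mem_coe.2 (Finset.mem_range.2 hij)) hz.1)
        intro i j hij
        rcases lt_or_gt_of_ne hij with h | h
        exacts [hlt i j h, (hlt j i h).symm]
      -- `Y (f k)` is covered by this difference and its intersections with earlier members; these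
      -- are finitely many and of rank below β.
      · refine MorleyRankGe.of_union_finset (V := fun j => Y (f j) ∩ Y (f k))
          ((hY _).diff (hdef k)) (Finset.range k) (fun j _ => (hY _).inter (hY _))
          ((hr (f k)).mono fun z hz => ?_) fun j hj => (hf j k (Finset.mem_range.1 hj)).2
        by_cases h : z ∈ ⋃ j ∈ Finset.range k, Y (f j)
        · right
          simp only [Set.mem_iUnion] at h ⊢
          obtain ⟨j, hj, h⟩ := h
          exact ⟨j, hj, h, hz⟩
        · exact .inl ⟨hz, h⟩

theorem definableOver_image {D : Set (Fin 2 → S.Carrier)} (hD : TupleDef A (Fin 2) D)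
    {X : Set S.Carrier} (hX : DefinableOver A S.toEq X) :
    DefinableOver A S.toEq {y | ∃ x ∈ X, ![x, y] ∈ D} := by
  have h := (TupleDef.map (hD.inter (tupleDef_apply_mem hX 0))
    (singleton_injective (1 : Fin 2))).const_mem
  convert h using 1
  ext y
  constructor
  · rintro ⟨x, hx, hxy⟩
    exact ⟨![x, y], ⟨hxy, hx⟩, comp_singleton _ _⟩
  · rintro ⟨u, ⟨hu, hu0⟩, huy⟩
    have h1 : u 1 = y := congrFun huy 0
    have h2 : ![u 0, y] = u := by
      funext k; fin_cases k
      exacts [rfl, h1.symm]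
    exact ⟨u 0, hu0, by rwa [h2]⟩

/-- The image of a definable set under a definable relation defined on it does not have smaller
Morley rank if the fibres over the image are uniformly finite. -/
theorem MorleyRankGe.image {D : Set (Fin 2 → S.Carrier)}
    (hD : TupleDef (Set.univ : Set (Imag L M)) (Fin 2) D) {n : ℕ}
    (hn : ∀ b, {a | ![a, b] ∈ D}.encard ≤ n) {X : Set S.Carrier} {α : Ordinal.{w}}
    (h : MorleyRankGe X α) (hX : ∀ x ∈ X, ∃ y, ![x, y] ∈ D) :
    MorleyRankGe {y | ∃ x ∈ X, ![x, y] ∈ D} α := by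
  induction α using WellFoundedLT.induction generalizing X with
  | ind α ih =>
    refine morleyRankGe_iff.2 ⟨?_, fun β hβ => ?_⟩
    · obtain ⟨x, hx⟩ := h.nonempty
      obtain ⟨y, hy⟩ := hX x hx
      exact ⟨y, x, hx, hy⟩
    · obtain ⟨Y, hY, hYX, hd, hr⟩ := (morleyRankGe_iff.1 h).2 β hβ
      refine .of_bounded_overlap n (Y := fun i => {y | ∃ x ∈ Y i, ![x, y] ∈ D})
        (fun i => definableOver_image hD (hY i))
        (fun i y ⟨x, hx, hxy⟩ => ⟨x, hYX i hx, hxy⟩)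
        (fun i => ih β hβ (hr i) fun x hx => hX x (hYX i hx)) fun z => ?_
      have hch : ∀ i : {i | z ∈ {y | ∃ x ∈ Y i, ![x, y] ∈ D}}, ∃ x ∈ Y i, ![x, z] ∈ D :=
        fun i => i.2
      choose g hg hgz using hch
      refine le_trans ?_ (hn z)
      -- Each index whose image contains z provides a point of the fibre over z, and disjoint `Y i`
      -- provide distinct points.
      refine Function.Embedding.encard_le ⟨fun i => ⟨g i, hgz i⟩, fun i j hij => ?_⟩
      have hij' : g i = g j := congrArg Subtype.val hij
      by_contra hne
      exact Set.disjoint_left.1 (hd i j fun h => hne (Subtype.ext h)) (hg i) (hij' ▸ hg j)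

/-! ### Ranks of partial types and of elements over `A`. -/

section Rank

theorem le_morleyRank {X : Set S.Carrier} {β : Ordinal.{w}} (h : MorleyRankGe X β) :
    (((β : WithTop Ordinal.{w}) : WithBot (WithTop Ordinal.{w}))) ≤ morleyRank X := by
  rw [morleyRank, if_pos h.nonempty, WithBot.coe_le_coe]
  exact le_sSup ⟨β, rfl, h⟩

theorem morleyRank_le {X : Set S.Carrier} {β : Ordinal.{w}} (h : ¬ HasDisjointFamily X β) :
    morleyRank X ≤ (((β : WithTop Ordinal.{w}) : WithBot (WithTop Ordinal.{w}))) := by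
  rw [morleyRank]
  split_ifs
  · rw [WithBot.coe_le_coe]
    refine sSup_le ?_
    rintro _ ⟨α, rfl, hα⟩
    rw [WithTop.coe_le_coe]
    by_contra! hlt
    exact h ((morleyRankGe_iff.1 hα).2 β hlt)
  · exact bot_le

theorem morleyRank_eq_top {X : Set S.Carrier} (h : ∀ α, MorleyRankGe X α) :
    morleyRank X = ⊤ := by
  rw [morleyRank, if_pos (h 0).nonempty]
  refine congrArg WithBot.some (WithTop.eq_top_iff_forall_ge.2 fun α => ?_)
  exact le_sSup ⟨α, rfl, h α⟩

/-- The defining properties of a partial type of ordinal Morley rank `β`. -/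
theorem PartialType.exists_rank (π : PartialType A S) (hπ : π.morleyRank < ⊤) :
    ∃ β : Ordinal.{w},
      (∃ G, G.Finite ∧ G ⊆ π.formulas ∧ ¬ HasDisjointFamily (⋂₀ G) β) ∧
      ∀ G, G.Finite → G ⊆ π.formulas → MorleyRankGe (⋂₀ G) β := by
  have hex : ∃ α : Ordinal.{w}, ∃ G, G.Finite ∧ G ⊆ π.formulas ∧ ¬ MorleyRankGe (⋂₀ G) α := by
    by_contra! hcon
    refine hπ.ne (top_le_iff.1 (le_sInf ?_))
    rintro _ ⟨G, hG, hGπ, rfl⟩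
    rw [morleyRank_eq_top fun α => hcon α G hG hGπ]
  have hne : {α : Ordinal.{w} | ∃ G, G.Finite ∧ G ⊆ π.formulas ∧
      ¬ MorleyRankGe (⋂₀ G) α}.Nonempty := hex
  -- Take the least α that some finite conjunction fails to reach. The β < α at which its disjoint
  -- family is missing is then reached by every finite conjunction.
  obtain ⟨α, ⟨G, hG, hGπ, hα⟩, hmin⟩ := WellFounded.has_min
    (wellFounded_lt : WellFounded ((· < ·) : Ordinal.{w} → _ → Prop)) _ hne
  rw [morleyRankGe_iff] at hα
  push Not at hα
  obtain ⟨β, hβα, hβ⟩ := hα (π.consistent G hG hGπ)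
  refine ⟨β, ⟨G, hG, hGπ, hβ⟩, fun G' hG' hGπ' => ?_⟩
  by_contra hcon
  exact hmin β ⟨G', hG', hGπ', hcon⟩ hβα

/-- Every `A`-definable set containing `x` has Morley rank at least `β`. -/
def RankOverGe (A : Set (Imag L M)) (x : S.Carrier) (β : Ordinal.{w}) : Prop :=
  ∀ X, DefinableOver A S.toEq X → x ∈ X → MorleyRankGe X β

/-- A set of rank at least β is not covered by finitely many sets of smaller rank, so compactness
finds a realisation of `π` avoiding every `A`-definable set that does not have rank at least β. -/
theorem CompactOver.exists_rankOverGe (hS : CompactOver A S) (π : PartialType A S)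
    {β : Ordinal.{w}} (h : ∀ G, G.Finite → G ⊆ π.formulas → MorleyRankGe (⋂₀ G) β) :
    ∃ x ∈ π.realizations, RankOverGe A x β := by
  have hfin : ∀ (G : Set (Set S.Carrier)), G.Finite → G ⊆ π.formulas →
      ∀ V : Set (Set S.Carrier), V.Finite →
        (∀ X ∈ V, DefinableOver A S.toEq X ∧ ¬ MorleyRankGe X β) → (⋂₀ G \ ⋃₀ V).Nonempty := by
    intro G hG hGπ V hV hVβ
    by_contra hcon
    have hsub : ⋂₀ G ⊆ ∅ ∪ ⋃ X ∈ hV.toFinset, id X := by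
      rw [Set.not_nonempty_iff_eq_empty, Set.sdiff_eq_empty, Set.sUnion_eq_biUnion] at hcon
      simpa using hcon
    have := MorleyRankGe.of_union_finset (V := id) (DefinableOver.empty) hV.toFinset
      (fun X hX => (hVβ X (hV.mem_toFinset.1 hX)).1.mono (Set.subset_univ _))
      ((h G hG hGπ).mono hsub) fun X hX => (hVβ X (hV.mem_toFinset.1 hX)).2
    exact Set.not_nonempty_empty this.nonempty
  -- The tuple to be extended is empty, so compactness just yields a point.
  obtain ⟨u, -, hu⟩ : ∃ u : Fin 1 → S.Carrier, u ∘ (Empty.elim : Empty → Fin 1) =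
      (fun i => i.elim) ∧ ∀ X ∈ {X : Set (Fin 1 → S.Carrier) | ∃ G V, G.Finite ∧
        G ⊆ π.formulas ∧ V.Finite ∧ (∀ X ∈ V, DefinableOver A S.toEq X ∧ ¬ MorleyRankGe X β) ∧
        X = {u : Fin 1 → S.Carrier | u 0 ∈ ⋂₀ G \ ⋃₀ V}}, u ∈ X := by
    refine hS _ (fun i => i.elim) _ _ ⟨_, ∅, ∅, Set.finite_empty, Set.empty_subset _,
      Set.finite_empty, by simp, rfl⟩ ?_ ?_ ?_
    · rintro _ ⟨G, V, hG, hGπ, hV, hVβ, rfl⟩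
      refine tupleDef_apply_mem (.diff (.sInter hG fun X hX => π.definable X (hGπ hX)) ?_) 0
      have := DefinableOver.finset_union (X := id) (A := A) (q := S.toEq) hV.toFinset
        fun X hX => (hVβ X (hV.mem_toFinset.1 hX)).1
      rw [Set.sUnion_eq_biUnion]
      simpa using this
    · rintro _ ⟨G, V, hG, hGπ, hV, hVβ, rfl⟩ _ ⟨G', V', hG', hGπ', hV', hVβ', rfl⟩
      refine ⟨_, ⟨G ∪ G', V ∪ V', hG.union hG', Set.union_subset hGπ hGπ', hV.union hV',
        fun X hX => hX.elim (hVβ X) (hVβ' X), rfl⟩, ?_⟩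
      rintro u ⟨hu1, hu2⟩
      rw [Set.sInter_union] at hu1
      rw [Set.sUnion_union] at hu2
      exact ⟨⟨hu1.1, fun h => hu2 (.inl h)⟩, ⟨hu1.2, fun h => hu2 (.inr h)⟩⟩
    · rintro _ ⟨G, V, hG, hGπ, hV, hVβ, rfl⟩
      obtain ⟨x, hx⟩ := hfin G hG hGπ V hV hVβ
      exact ⟨![x], hx, funext fun i => i.elim⟩
  refine ⟨u 0, fun X hX => ?_, fun X hX hx => ?_⟩
  · exact (hu _ ⟨{X}, ∅, Set.finite_singleton _, by simpa using hX, Set.finite_empty, by simp,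
      rfl⟩).1 X rfl
  · by_contra hβ
    exact (hu _ ⟨∅, {X}, Set.finite_empty, Set.empty_subset _, Set.finite_singleton _,
      by simpa using ⟨hX, hβ⟩, rfl⟩).2 ⟨X, rfl, hx⟩

/-- For an `A`-definable `X` containing `y`, a relation `D` containing (y, x) with bounded fibres
over its first coordinate maps `X` to a set containing `x`, hence of rank at least β. Reversing `D`
maps this set back into `X` with bounded fibres, so the rank does not drop. -/
theorem CompactOver.rankOverGe_of_interalg (hS : CompactOver A S) {x y : S.Carrier}
    {β : Ordinal.{w}} (hx : RankOverGe A x β) (hxy : Interalg A x y) : RankOverGe A y β := by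
  intro X hX hy
  obtain ⟨D, hD, hyx, n, hn⟩ := hS.exists_bounded hxy.2
  have h1 := hx _ (definableOver_image hD hX) ⟨y, hy, hyx⟩
  have h2 := MorleyRankGe.image (D := {v | v ∘ ![1, 0] ∈ D} ∩ {v | v 1 ∈ X}) (n := n)
    (.mono (.inter (hD.comap _) (tupleDef_apply_mem hX 1)) (Set.subset_univ _))
    (fun b => (Set.encard_le_encard fun a ha => by
      have := ha.1
      rwa [Set.mem_ofPred_eq, comp_pair] at this).trans (hn b)) h1
    (fun a ⟨b, hb, hba⟩ => ⟨b, by rw [Set.mem_ofPred_eq, comp_pair]; exact hba, hb⟩)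
  exact h2.mono fun b ⟨a, _, hab⟩ => hab.2

end Rank

/-! ### Complete types of elements; finitely many types of maximal rank. -/

section Types

theorem eqType_singleton_iff {x y : S.Carrier} :
    EqType A ![x] ![y] ↔ ∀ X, DefinableOver A S.toEq X → (x ∈ X ↔ y ∈ X) := by
  refine ⟨fun h X hX => h _ (tupleDef_apply_mem hX 0), fun h X hX => h _ hX.const_mem⟩

/-- The complete type over `A` of an element. -/
def typeOver (A : Set (Imag L M)) (x : S.Carrier) : PartialType A S where
  formulas := {X | DefinableOver A S.toEq X ∧ x ∈ X}
  definable _ h := h.1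
  consistent _ _ h := ⟨x, fun _ hX => (h hX).2⟩

theorem mem_realizations_typeOver {x y : S.Carrier} :
    y ∈ (typeOver A x).realizations ↔ EqType A ![y] ![x] := by
  rw [eqType_singleton_iff]
  constructor
  · exact fun h X hX => ⟨fun h1 => by_contra fun h2 => h Xᶜ ⟨hX.compl, h2⟩ h1,
      fun h1 => h X ⟨hX, h1⟩⟩
  · exact fun h X hX => (h X hX.1).2 hX.2

theorem typeOver_isCompletionOf {π : PartialType A S} {x : S.Carrier}
    (hx : x ∈ π.realizations) : (typeOver A x).IsCompletionOf π := by
  refine ⟨fun X hX => ?_, fun X hX => ⟨π.definable X hX, hx X hX⟩⟩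
  by_cases h : x ∈ X
  exacts [.inl ⟨hX, h⟩, .inr ⟨hX.compl, h⟩]

/-- Every completion contains the formulas of `G`, so its rank is at most β, while every finite
conjunction in the type of `x` has rank at least β. -/
theorem typeOver_isMaxRankCompletionOf {π : PartialType A S} {x : S.Carrier}
    (hx : x ∈ π.realizations) {β : Ordinal.{w}} (hxβ : RankOverGe A x β)
    (hβ : ∃ G, G.Finite ∧ G ⊆ π.formulas ∧ ¬ HasDisjointFamily (⋂₀ G) β) :
    (typeOver A x).IsMaxRankCompletionOf π := by
  refine ⟨typeOver_isCompletionOf hx, fun q hq => ?_⟩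
  obtain ⟨G, hG, hGπ, hGβ⟩ := hβ
  have hle : q.morleyRank ≤ morleyRank (⋂₀ G) := sInf_le ⟨G, hG, hGπ.trans hq.2, rfl⟩
  refine hle.trans ((morleyRank_le hGβ).trans (le_sInf ?_))
  rintro _ ⟨V, hV, hVx, rfl⟩
  exact le_morleyRank (hxβ _ (.sInter hV fun X hX => (hVx hX).1) fun X hX => (hVx hX).2)

/-- Equality of types over `A`. -/
def eqTypeSetoid (A : Set (Imag L M)) (S : ImagSort L M) (I : Type) :
    Setoid (I → S.Carrier) where
  r := EqType A
  iseqv := ⟨.refl, .symm, .trans⟩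

/-- The type over `A` of a tuple. -/
def tupleType (A : Set (Imag L M)) {I : Type} (v : I → S.Carrier) :
    Quotient (eqTypeSetoid A S I) := Quotient.mk _ v

theorem tupleType_eq_iff {I : Type} {v v' : I → S.Carrier} :
    tupleType A v = tupleType A v' ↔ EqType A v v' := Quotient.eq

/-- Only finitely many types over `A` of rank at least `β` contain a given formula that does not
have infinitely many disjoint subsets of rank at least `β`. -/
theorem finite_tupleType_image {Z P : Set S.Carrier} {β : Ordinal.{w}}
    (hZ : DefinableOver A S.toEq Z) (hP : P ⊆ Z) (hPβ : ∀ x ∈ P, RankOverGe A x β)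
    (hβ : ¬ HasDisjointFamily Z β) : ((fun x => tupleType A ![x]) '' P).Finite := by
  by_contra hinf
  -- If there were infinitely many types, a definable set meeting infinitely many of them could be
  -- split, keeping a half that still does and discarding a half that meets `P`. Iterating, the
  -- discarded parts are disjoint and of rank at least β.
  let T := {V : Set S.Carrier // DefinableOver A S.toEq V ∧
    ((fun x => tupleType A ![x]) '' (V ∩ P)).Infinite}
  have hstep : ∀ V : T, ∃ V' : T, V'.1 ⊆ V.1 ∧ ((V.1 \ V'.1) ∩ P).Nonempty := by
    rintro ⟨V, hV, hVinf⟩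
    obtain ⟨_, ⟨x, hx, rfl⟩, _, ⟨y, hy, rfl⟩, hne⟩ := hVinf.nontrivial
    obtain ⟨X, hX, hxX, hyX⟩ : ∃ X, DefinableOver A S.toEq X ∧ x ∈ X ∧ y ∉ X := by
      by_contra! hcon
      refine hne (tupleType_eq_iff.2 (eqType_singleton_iff.2 fun X hX => ⟨hcon X hX, fun h => ?_⟩))
      by_contra hxX
      exact hcon Xᶜ hX.compl hxX h
    have hunion : V ∩ P = ((V ∩ X) ∩ P) ∪ ((V \ X) ∩ P) := by
      rw [← Set.union_inter_distrib_right, Set.inter_union_sdiff]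
    rw [hunion, Set.image_union, Set.infinite_union] at hVinf
    rcases hVinf with h | h
    · exact ⟨⟨V ∩ X, hV.inter hX, h⟩, Set.inter_subset_left,
        ⟨y, ⟨hy.1, fun h => hyX h.2⟩, hy.2⟩⟩
    · exact ⟨⟨V \ X, hV.diff hX, h⟩, Set.sdiff_subset, ⟨x, ⟨hx.1, fun h => h.2 hxX⟩, hx.2⟩⟩
  choose step hsub hne using hstep
  let V : ℕ → T := fun n => step^[n] ⟨Z, hZ, by rwa [Set.inter_eq_right.2 hP]⟩
  have hV : ∀ n, V (n + 1) = step (V n) := fun n => Function.iterate_succ_apply' _ _ _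
  have hanti : Antitone fun n => (V n).1 := antitone_nat_of_succ_le fun n => by
    rw [hV]; exact hsub _
  have hdef : ∀ n, DefinableOver A S.toEq ((V n).1 \ (V (n + 1)).1) :=
    fun n => (V n).2.1.diff (V (n + 1)).2.1
  refine hβ ⟨fun n => (V n).1 \ (V (n + 1)).1, fun n => (hdef n).mono (Set.subset_univ _),
    fun n => Set.sdiff_subset.trans (hanti (Nat.zero_le n)), ?_, fun n => ?_⟩
  · have hlt : ∀ i j, i < j → Disjoint ((V i).1 \ (V (i + 1)).1) ((V j).1 \ (V (j + 1)).1) :=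
      fun i j hij => Set.disjoint_left.2 fun z hz hz' => hz.2 (hanti hij hz'.1)
    intro i j hij
    rcases lt_or_gt_of_ne hij with h | h
    exacts [hlt i j h, (hlt j i h).symm]
  · obtain ⟨x, hx, hxP⟩ := hne (V n)
    rw [← hV] at hx
    exact hPβ x hxP _ (hdef n) hx

end Types

/-! ### Weighted double counting. -/

theorem ncard_conjugates_one (x y : S.Carrier) :
    (conjugates A (![1] : Fin 1 → Fin 2) ![x, y]).ncard = degreeOver A y x := by
  have hinj : Function.Injective fun v : Fin 2 → S.Carrier => v ∘ (![1, 0] : Fin 2 → Fin 2) :=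
    fun v v' h => by
      funext k; fin_cases k
      exacts [congrFun h 1, congrFun h 0]
  rw [degreeOver, ← hinj.injOn.ncard_image]
  congr 1
  ext v
  constructor
  · rintro ⟨u, ⟨h1, h2⟩, rfl⟩
    refine ⟨?_, ?_⟩
    · have := congrFun h1 0
      exact funext fun k => by fin_cases k; exact this
    · have := h2.comp (![1, 0] : Fin 2 → Fin 2)
      rwa [comp_pair ![x, y] 1 0] at this
  · rintro ⟨h1, h2⟩
    refine ⟨v ∘ ![1, 0], ⟨?_, ?_⟩, ?_⟩
    · have := congrFun h1 0
      exact funext fun k => by fin_cases k; exact this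
    · have := h2.comp (![1, 0] : Fin 2 → Fin 2)
      rwa [comp_pair ![y, x] 1 0] at this
    · funext k; fin_cases k <;> rfl

/-- Double counting: a type-invariant relation on a set with finitely many types is balanced if
there is a type-invariant weight that satisfies detailed balance. -/
theorem CompactOver.eq_of_weight (hS : CompactOver A S) {C : Set (Fin 2 → S.Carrier)}
    (hC : ∀ u ∈ C, ∀ u', EqType A u' u → u' ∈ C) {X : Set S.Carrier}
    (hX : ∀ u ∈ C, u 0 ∈ X ↔ u 1 ∈ X)
    (hXfin : ((fun x => tupleType A ![x]) '' X).Finite) (hXne : X.Nonempty)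
    (W : S.Carrier → ℚ) (hW : ∀ x ∈ X, 0 < W x)
    (hWX : ∀ x ∈ X, ∀ y ∈ X, EqType A ![x] ![y] → W x = W y)
    (hbal : ∀ u ∈ C, u 0 ∈ X → W (u 0) * (conjugates A (![0] : Fin 1 → Fin 2) u).ncard =
      W (u 1) * (conjugates A (![1] : Fin 1 → Fin 2) u).ncard)
    (n : Fin 2 → ℕ) (hn : ∀ i, ∀ x ∈ X, {u | u ∈ C ∧ u i = x}.encard = n i) : n 0 = n 1 := by
  classical
  -- `R` has exactly one representative of each type in `X`; it makes both weighted sums finite.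
  obtain ⟨R, hRX, hR⟩ := Set.exists_subset_bijOn X fun x => tupleType A ![x]
  have hRfin : R.Finite := Set.Finite.of_finite_image (by rwa [hR.image_eq]) hR.injOn
  have hRne : R.Nonempty := by
    rw [← Set.image_nonempty, hR.image_eq]
    exact hXne.image _
  have hfib : ∀ i, ∀ x ∈ X, {u | u ∈ C ∧ u i = x}.Finite := fun i x hx =>
    Set.finite_of_encard_eq_coe (hn i x hx)
  have hP : ∀ i, {u | u ∈ C ∧ u i ∈ R}.Finite := fun i =>
    (hRfin.biUnion fun x hx => hfib i x (hRX hx)).subset fun u hu =>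
      Set.mem_biUnion hu.2 ⟨hu.1, rfl⟩
  let P : Fin 2 → Finset (Fin 2 → S.Carrier) := fun i => (hP i).toFinset
  have hPmem : ∀ i u, u ∈ P i ↔ u ∈ C ∧ u i ∈ R := fun i u => (hP i).mem_toFinset
  have hCX : ∀ u ∈ C, ∀ i j, u i ∈ X → u j ∈ X := by
    intro u hu i j
    have := hX u hu
    fin_cases i <;> fin_cases j <;> simp <;> tauto
  have hrow : ∀ i, ∑ u ∈ P i, W (u i) = n i * ∑ x ∈ hRfin.toFinset, W x := by
    intro i
    rw [← Finset.sum_fiberwise_of_maps_to (g := fun u => u i) (t := hRfin.toFinset)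
      (fun u hu => hRfin.mem_toFinset.2 ((hPmem i u).1 hu).2), Finset.mul_sum]
    refine Finset.sum_congr rfl fun x hx => ?_
    have hxR := hRfin.mem_toFinset.1 hx
    have hcard : ((P i).filter fun u => u i = x).card = n i := by
      have h1 := hn i x (hRX hxR)
      have h2 : {u | u ∈ C ∧ u i = x} = ((P i).filter fun u => u i = x : Finset _) := by
        ext u
        simp only [Finset.coe_filter, hPmem, Set.mem_ofPred_eq]
        exact ⟨fun h => ⟨⟨h.1, h.2 ▸ hxR⟩, h.2⟩, fun h => ⟨h.1.1, h.2⟩⟩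
      rw [h2, Set.encard_coe_eq_coe_finsetCard] at h1
      exact_mod_cast h1
    rw [Finset.sum_congr rfl fun u hu => congrArg W (Finset.mem_filter.1 hu).2,
      Finset.sum_const, hcard, nsmul_eq_mul]
  -- As `R` has a single element of each type, pairs in `P i` of the same type as `u` share its i-th
  -- entry, so they are exactly its conjugates over that entry.
  have hclass : ∀ i, ∀ u ∈ P i, ∑ u' ∈ P i with tupleType A u' = tupleType A u, W (u' i) =
      W (u i) * (conjugates A (![i] : Fin 1 → Fin 2) u).ncard := by
    intro i u hu
    obtain ⟨huC, huR⟩ := (hPmem i u).1 hu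
    have hset : (((P i).filter fun u' => tupleType A u' = tupleType A u : Finset _) :
        Set (Fin 2 → S.Carrier)) = conjugates A (![i] : Fin 1 → Fin 2) u := by
      ext u'
      simp only [Finset.coe_filter, hPmem, Set.mem_ofPred_eq, tupleType_eq_iff]
      constructor
      · rintro ⟨⟨-, h2⟩, h3⟩
        refine ⟨?_, h3⟩
        rw [comp_singleton, comp_singleton]
        exact congrArg (![·]) (hR.injOn h2 huR (tupleType_eq_iff.2 (h3.single rfl rfl)))
      · rintro ⟨h1, h2⟩
        have h3 : u' i = u i := congrFun h1 0
        exact ⟨⟨hC u huC u' h2, h3 ▸ huR⟩, h2⟩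
    rw [← hset, Set.ncard_coe_finset, mul_comm, ← nsmul_eq_mul, ← Finset.sum_const]
    refine Finset.sum_congr rfl fun u' hu' => ?_
    rw [← Finset.mem_coe, hset] at hu'
    exact congrArg W (congrFun hu'.1 0)
  -- Any pair in `C` over `X` can be moved within its type so that its j-th entry is a
  -- representative; hence `P 0` and `P 1` realise the same pair types.
  have htransfer : ∀ i j, ∀ u ∈ P i, ∃ u' ∈ P j, EqType A u' u := by
    intro i j u hu
    obtain ⟨huC, huR⟩ := (hPmem i u).1 hu
    have hj : u j ∈ X := hCX u huC i j (hRX huR)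
    obtain ⟨r, hr, hrj⟩ := hR.surjOn ⟨u j, hj, rfl⟩
    obtain ⟨u', h1, h2⟩ := hS.exists_extension (singleton_injective j) (u := u) (v := ![r])
      (by rw [comp_singleton]; exact (tupleType_eq_iff.1 hrj).symm)
    have h3 : u' j = r := congrFun h1 0
    exact ⟨u', (hPmem j u').2 ⟨hC u huC u' h2, h3 ▸ hr⟩, h2⟩
  have himage : (P 0).image (tupleType A) = (P 1).image (tupleType A) := by
    ext q
    simp only [Finset.mem_image]
    constructor
    · rintro ⟨u, hu, rfl⟩
      obtain ⟨u', hu', h⟩ := htransfer 0 1 u hu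
      exact ⟨u', hu', tupleType_eq_iff.2 h⟩
    · rintro ⟨u, hu, rfl⟩
      obtain ⟨u', hu', h⟩ := htransfer 1 0 u hu
      exact ⟨u', hu', tupleType_eq_iff.2 h⟩
  -- Group both sums by pair type: `hclass` evaluates each group, and detailed balance together with
  -- invariance of `W` matches them.
  have hsum : ∑ u ∈ P 0, W (u 0) = ∑ u ∈ P 1, W (u 1) := by
    rw [← Finset.sum_fiberwise_of_maps_to (g := tupleType A) (t := (P 0).image (tupleType A))
      (fun u hu => Finset.mem_image_of_mem _ hu),
      ← Finset.sum_fiberwise_of_maps_to (s := P 1) (g := tupleType A)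
        (t := (P 1).image (tupleType A)) (fun u hu => Finset.mem_image_of_mem _ hu), ← himage]
    refine Finset.sum_congr rfl fun q hq => ?_
    obtain ⟨u, hu, rfl⟩ := Finset.mem_image.1 hq
    obtain ⟨u', hu', h⟩ := htransfer 0 1 u hu
    rw [hclass 0 u hu, ← tupleType_eq_iff.2 h, hclass 1 u' hu', hS.ncard_conjugates_eq h]
    obtain ⟨huC, huR⟩ := (hPmem 0 u).1 hu
    have hu0 : u 0 ∈ X := hRX huR
    rw [hbal u huC hu0, hWX (u' 1) (hRX ((hPmem 1 u').1 hu').2) (u 1) ((hX u huC).1 hu0)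
      (h.single rfl rfl)]
  rw [hrow, hrow] at hsum
  have hpos : 0 < ∑ x ∈ hRfin.toFinset, W x :=
    Finset.sum_pos (fun x hx => hW x (hRX (hRfin.mem_toFinset.1 hx)))
      ((Set.Finite.toFinset_nonempty hRfin).2 hRne)
  exact_mod_cast mul_right_cancel₀ hpos.ne' hsum

/-! ### Correspondences, interalgebraicity and measurability. -/

theorem TypeDefinableOver.mem_of_eqType {C : Set (S.Carrier × S.Carrier)}
    (hC : TypeDefinableOver A (S.pairToEq S) C) {x y x' y' : S.Carrier} (h : (x, y) ∈ C)
    (h' : EqType A ![x', y'] ![x, y]) : (x', y') ∈ C := by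
  obtain ⟨F, hF, rfl⟩ := hC
  exact fun Y hY => (h' _ (tupleDef_pair_mem (hF Y hY))).2 (h Y hY)

theorem typeDefinableOver_eqType (x y : S.Carrier) :
    TypeDefinableOver A (S.pairToEq S) {p | EqType A ![p.1, p.2] ![x, y]} := by
  refine ⟨{Y | ∃ X, TupleDef A (Fin 2) X ∧ ![x, y] ∈ X ∧ Y = {p | ![p.1, p.2] ∈ X}}, ?_, ?_⟩
  · rintro _ ⟨X, hX, -, rfl⟩
    exact hX.pair_mem
  · ext p
    constructor
    · rintro h _ ⟨X, hX, hxy, rfl⟩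
      exact (h X hX).2 hxy
    · intro h X hX
      exact ⟨fun h1 => by_contra fun h2 => h _ ⟨Xᶜ, DefinableOver.compl hX, h2, rfl⟩ h1,
        fun h1 => h _ ⟨X, hX, h1, rfl⟩⟩

/-- Completing `a` to a pair (a, b) of the given type identifies the fibre with the conjugates of
`b` over `a`, whose number depends only on the type of the pair. -/
theorem CompactOver.encard_fibre (hS : CompactOver A S) {x y a : S.Carrier}
    (h : EqType A ![a] ![x]) (hxy : IsAlgOver A x y) :
    {b | EqType A ![a, b] ![x, y]}.encard = degreeOver A x y := by
  obtain ⟨b, hb⟩ := hS.exists_extension_pair (y := y) h.symm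
  have hset : {b | EqType A ![a, b] ![x, y]} = {b' | EqType A ![a, b'] ![a, b]} := by
    ext b'
    exact ⟨fun h => h.trans hb.symm, fun h => h.trans hb⟩
  rw [hset, ← (isAlgOver_iff.1 (hS.isAlgOver_of_eqType hb.symm hxy)).cast_ncard_eq,
    ← degreeOver_eq, hS.degreeOver_eq_of_eqType hb]

/-- In a measurable type, interalgebraic elements have the same degree over each other. -/
theorem CompactOver.degreeOver_comm (hS : CompactOver A S) {x y : S.Carrier}
    (hx : (typeOver A x).IsMeasurable) (h : EqType A ![y] ![x]) (hxy : Interalg A x y) :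
    degreeOver A x y = degreeOver A y x := by
  have hswap : ∀ b, {a | EqType A ![a, b] ![x, y]} = {a | EqType A ![b, a] ![y, x]} :=
    fun b => Set.ext fun a => ⟨EqType.swap, EqType.swap⟩
  have h1 : ∀ a ∈ (typeOver A x).realizations,
      {b | EqType A ![a, b] ![x, y]}.encard = degreeOver A x y := fun a ha =>
    hS.encard_fibre (mem_realizations_typeOver.1 ha) hxy.1
  have h2 : ∀ b ∈ (typeOver A x).realizations,
      {a | EqType A ![a, b] ![x, y]}.encard = degreeOver A y x := fun b hb => by
    rw [hswap]
    exact hS.encard_fibre ((mem_realizations_typeOver.1 hb).trans h.symm) hxy.2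
  -- The pairs of the same type as (x, y) form a uniform correspondence on the type of `x`, whose
  -- fibre sizes are the two degrees.
  obtain ⟨-, k, l, ⟨hk, hl⟩, hkl⟩ := hx {p | EqType A ![p.1, p.2] ![x, y]}
    ⟨⟨typeDefinableOver_eqType x y, ⟨(x, y), EqType.refl _⟩, fun p hp =>
      ⟨mem_realizations_typeOver.2 (EqType.single (i := 0) hp rfl rfl),
        mem_realizations_typeOver.2 ((EqType.single (i := 1) hp rfl rfl).trans h)⟩,
      fun a ha => Set.finite_of_encard_eq_coe (h1 a ha),
      fun b hb => Set.finite_of_encard_eq_coe (h2 b hb)⟩, _, _, h1, h2⟩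
  have hxr : x ∈ (typeOver A x).realizations := mem_realizations_typeOver.2 (.refl _)
  have e1 := (h1 x hxr).symm.trans (hk x hxr)
  have e2 := (h2 x hxr).symm.trans (hl x hxr)
  rw [Nat.cast_inj] at e1 e2
  rw [e1, e2, hkl]

/-- The fibre of `C` through a pair contains all conjugates of the other entry, so finite fibres
give algebraicity both ways. -/
theorem TypeDefinableOver.interalg {C : Set (S.Carrier × S.Carrier)}
    (hC : TypeDefinableOver A (S.pairToEq S) C) {x y : S.Carrier} (h : (x, y) ∈ C)
    (h1 : {b | (x, b) ∈ C}.Finite) (h2 : {a | (a, y) ∈ C}.Finite) : Interalg A x y :=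
  ⟨isAlgOver_iff.2 (h1.subset fun _ hb => hC.mem_of_eqType h hb),
    isAlgOver_iff.2 (h2.subset fun _ ha => hC.mem_of_eqType h (EqType.swap ha))⟩

end EqModel

theorem mainTheorem5 {L : FirstOrder.Language.{u, v}} {M : Type w} [L.Structure M]
    (κ : Cardinal.{w}) (hκ : Cardinal.aleph0 ≤ κ) (hM : EqModel.IsSaturated L M κ)
    (A : Set (EqModel.Imag L M)) (hA : Cardinal.mk A < κ)
    (S : EqModel.ImagSort L M) (π : EqModel.PartialType A S)
    (hπ : π.morleyRank < ⊤)
    (hmeas : ∀ p : EqModel.PartialType A S, p.IsMaxRankCompletionOf π → p.IsMeasurable) :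
    π.IsMeasurable := by
  open EqModel in
  have hS : CompactOver A S := hM.compactOver hκ hA S
  obtain ⟨β, hβ, hge⟩ := π.exists_rank hπ
  obtain ⟨x₀, hx₀, hx₀β⟩ := hS.exists_rankOverGe π hge
  rintro C ⟨hcorr, k, l, hk, hl⟩
  refine ⟨hcorr, k, l, ⟨hk, hl⟩, ?_⟩
  obtain ⟨hC, -, hCπ, hfin₁, hfin₂⟩ := hcorr
  -- One interalgebraicity class: it is closed under `C`, contains only maximal-rank elements, and
  -- has x₀ as a base point for the weight.
  let X : Set S.Carrier := {x | x ∈ π.realizations ∧ Interalg A x₀ x}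
  let C' : Set (Fin 2 → S.Carrier) := {u | (u 0, u 1) ∈ C}
  have heta : ∀ u : Fin 2 → S.Carrier, ![u 0, u 1] = u := fun u => by
    funext k; fin_cases k <;> rfl
  have hXβ : ∀ x ∈ X, RankOverGe A x β := fun x hx => hS.rankOverGe_of_interalg hx₀β hx.2
  have hCalg : ∀ u ∈ C', Interalg A (u 0) (u 1) := fun u hu =>
    hC.interalg hu (hfin₁ _ (hCπ hu).1) (hfin₂ _ (hCπ hu).2)
  -- This is where measurability of the maximal completions enters.
  have hcomm : ∀ x ∈ X, ∀ y ∈ X, EqType A ![x] ![y] → degreeOver A x y = degreeOver A y x :=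
    fun x hx y hy h => hS.degreeOver_comm
      (hmeas _ (typeOver_isMaxRankCompletionOf hx.1 (hXβ x hx) hβ)) h.symm
      (hS.interalg_trans hx.2.symm hy.2)
  have hpos : ∀ x ∈ X, 0 < (degreeOver A x₀ x : ℚ) ∧ 0 < (degreeOver A x x₀ : ℚ) := fun x hx =>
    ⟨Nat.cast_pos.2 hx.2.1.degreeOver_pos, Nat.cast_pos.2 hx.2.2.degreeOver_pos⟩
  have hcocycle : ∀ x ∈ X, ∀ y ∈ X, Interalg A x y →
      (degreeOver A x₀ x / degreeOver A x x₀ : ℚ) * degreeOver A x y =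
        (degreeOver A x₀ y / degreeOver A y x₀ : ℚ) * degreeOver A y x := by
    intro x hx y hy hxy
    have h : (degreeOver A x₀ x : ℚ) * degreeOver A x y * degreeOver A y x₀ =
        degreeOver A x x₀ * degreeOver A y x * degreeOver A x₀ y := by
      exact_mod_cast hS.degreeOver_cocycle hx.2 hxy hy.2
    have h1 := (hpos x hx).2.ne'
    have h2 := (hpos y hy).2.ne'
    field_simp
    linear_combination h
  refine hS.eq_of_weight (C := C') (X := X) ?_ ?_ ?_ ⟨x₀, hx₀, .refl x₀⟩
    (fun x => degreeOver A x₀ x / degreeOver A x x₀)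
    (fun x hx => div_pos (hpos x hx).1 (hpos x hx).2) ?_ ?_ ![k, l] ?_
  · intro u hu u' h
    rw [← heta u, ← heta u'] at h
    exact hC.mem_of_eqType hu h
  · intro u hu
    exact ⟨fun h => ⟨(hCπ hu).2, hS.interalg_trans h.2 (hCalg u hu)⟩,
      fun h => ⟨(hCπ hu).1, hS.interalg_trans h.2 (hCalg u hu).symm⟩⟩
  · obtain ⟨G, hG, hGπ, hGβ⟩ := hβ
    exact finite_tupleType_image (DefinableOver.sInter hG fun Y hY => π.definable Y (hGπ hY))
      (fun x hx Y hY => hx.1 Y (hGπ hY)) hXβ hGβ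
  -- For elements of equal type the two degrees in `hcocycle` agree and cancel, leaving equality of
  -- the weights.
  · intro x hx y hy h
    have hxy := hS.interalg_trans hx.2.symm hy.2
    have := hcocycle x hx y hy hxy
    rw [hcomm x hx y hy h] at this
    exact mul_right_cancel₀ (Nat.cast_pos.2 hxy.2.degreeOver_pos).ne' this
  · intro u hu hu0
    have h := hcocycle (u 0) hu0 (u 1)
      ⟨(hCπ hu).2, hS.interalg_trans hu0.2 (hCalg u hu)⟩ (hCalg u hu)
    rw [← ncard_conjugates_one (u 0) (u 1), degreeOver.eq_1 A (u 0) (u 1), heta] at h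
    exact h
  · intro i x hx
    fin_cases i
    · refine Eq.trans ?_ (hk x hx.1)
      rw [← (cons_pair_injective x).encard_image]
      congr 1
      ext u
      constructor
      · rintro ⟨hu, rfl⟩
        exact ⟨u 1, hu, heta u⟩
      · rintro ⟨y, hy, rfl⟩
        exact ⟨hy, rfl⟩
    · refine Eq.trans ?_ (hl x hx.1)
      have hinj : Function.Injective fun y : S.Carrier => ![y, x] := fun _ _ h => congrFun h 0
      rw [← hinj.encard_image]
      congr 1
      ext u
      constructor
      · rintro ⟨hu, rfl⟩
        exact ⟨u 0, hu, heta u⟩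
      · rintro ⟨y, hy, rfl⟩
        exact ⟨hy, rfl⟩
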